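/- **Setting.** Let $M>0$, $Q\in\mathbb R$ with $Q^2<M^2$, $f(\rho)=1-\frac{2M}{\rho}+\frac{Q^2}{\rho^2}$, $r_\pm=M\pm\sqrt{M^2-Q^2}$, and consider the non-extremal Reissner–Nordström metric in two space dimensions, in coordinates $(x_0,\rho,\varphi)$ with $\varphi$ a $2\pi$-periodic angle, $$ds^2=f\,dx_0^2-d\rho^2-\rho^2d\varphi^2-2(1-f)\,dx_0\,d\rho-(1-f)\,d\rho^2 ,$$ with its wave equation $\Box_gu=0$. All solutions below are $C^2$ solutions in a neighbourhood of the exterior $\{x_0=0,\ \rho>r_+\}$ of the initial slice, and the Klein–Gordon product is $$\langle u,v\rangle=i\int_0^\infty\!\!\int_0^{2\pi}\Big[(2-f)\big(\bar u\,\partial_{x_0}v-\partial_{x_0}\bar u\,v\big)+(f-1)\big(\bar u\,\partial_\rho v-\partial_\rho\bar u\,v\big)\Big]_{x_0=0}\rho\,d\varphi\,d\rho .$$ For $a>0$ and $k=(\eta,m')\in\mathbb R\times\mathbb Z$ let $f_k^\pm$ be solutions with, for $\rho>r_+$, $$f_k^\pm|_{x_0=0}=\gamma_ke^{i(\rho\eta+m'\varphi)},\qquad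 \partial_{x_0}f_k^\pm|_{x_0=0}=i\lambda_0^\mp(k)\gamma_ke^{i(\rho\eta+m'\varphi)},$$ $$\gamma_k=\frac{1}{2\pi\sqrt2\,\sqrt\rho\,(\eta^2+a^2)^{1/4}},\qquad \lambda_0^\pm(k)=\frac{-(f-1)\eta\pm\sqrt{\eta^2+a^2}}{2-f}.$$ For a wave packet $C$ put $C^+(k)=\langle f_k^+,C\rangle$ and $C^-(k)=-\langle f_{-k}^-,C\rangle$. Let $\varepsilon>0$, $\eta_0>0$, $m\in\mathbb Z$, $\hat\xi_0=\frac{2\eta_0r_+^2}{r_+-r_-}$, and let $\hat C=\hat C_a$ be a solution with, for $\rho>0$, $$\hat C|_{x_0=0}=\theta(\rho-r_+)\,\rho^{-1/2}(\rho-r_+)^{\varepsilon}e^{-a(\rho-r_+)}e^{i\hat\xi_0\ln|\rho-r_+|+im\varphi},\qquad \partial_{x_0}\hat C|_{x_0=0}=i\hat\beta\,\hat C|_{x_0=0},\qquad \hat\beta=\frac{-f\,\hat\xi_0}{(2-f)(\rho-r_+)} ,$$ and $\hat C_n=\hat C/\langle\hat C,\hat C\rangle^{1/2}$. **Quantum field.**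 Write $\int dk=\sum_{m'}\int d\eta$. The annihilation operators $\alpha_k^+$ and creation operators $\alpha_{-k}^-$ of the field $\Phi=\int(\alpha_k^+f_k^++\alpha_{-k}^-f_{-k}^-)\,dk$ are given, smeared with functions of $k$ in $L^2(\mathbb R\times\mathbb Z)$, on a complex vector space with a hermitian (possibly indefinite) form $\langle\cdot|\cdot\rangle$, with respect to which $\alpha_{-k}^-$ is the adjoint of $\alpha_k^+$; they satisfy $[\alpha_k^+,\alpha_{-k'}^-]=\delta(k-k')$, $[\alpha_k^+,\alpha_{k'}^+]=[\alpha_{-k}^-,\alpha_{-k'}^-]=0$. An Unruh-type vacuum is a vector $|\Psi\rangle$ with $\langle\Psi|\Psi\rangle=1$, $$\alpha_k^{++}|\Psi\rangle=0,\qquad \alpha_{-k}^{--}|\Psi\rangle=0\qquad\text{for all }k,$$ where $\alpha_k^{++}=\alpha_k^+$ for $\eta>0$ and $0$ for $\eta<0$, and $\alpha_{-k}^{--}=\alpha_{-k}^-$ for $\eta<0$ and $0$ for $\eta>0$. The number operator of a packet $C$ is $N(C)=\langle C,\Phi\rangle^*\langle C,\Phi\rangle$ with $\langle C,\Phi\rangle=\int\big(\overline{C^+(k)}\,\alpha_k^+-\overline{C^-(k)}\,\alpha_{-k}^-\big)dk$.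 **Theorem.** Such a representation with an Unruh-type vacuum exists. For every $a>0$ one has $\langle\hat C_n,\hat C_n\rangle=1$ and the coefficients $\hat C_n^\pm$ are in $L^2(\mathbb R\times\mathbb Z)$. For every choice, for each $a>0$, of such a representation and of an Unruh-type vacuum $|\Psi\rangle$ in it, $$\lim_{a\to\infty}\langle\Psi|N(\hat C_n)|\Psi\rangle=\frac{2^{2\varepsilon}\,e^{-2\pi\hat\xi_0}\,|\Gamma_1|^2}{2\pi\,\Gamma(2\varepsilon)}\cdot\frac{\hat\xi_0^2+\varepsilon^2}{\hat\xi_0}\int_{-\infty}^0\frac{|\eta|}{(\eta^2+1)^{\varepsilon+1}}\,e^{2\hat\xi_0\arcsin\frac{1}{\sqrt{\eta^2+1}}}\,d\eta ,$$ where $\Gamma_1=e^{\pi\hat\xi_0/2}\,\Gamma(i\hat\xi_0+\varepsilon)$. In particular the limit depends on the black hole only through $\hat\xi_0$. -/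

import Mathlib

open MeasureTheory Filter Topology Set Complex
open scoped ComplexConjugate

universe u

noncomputable section

namespace RN

/-! ### The Reissner-Nordström black hole in two space dimensions

The metric, in coordinates `(x₀, ρ, φ)`, is
`f dx₀² - dρ² - ρ² dφ² - 2 (1 - f) dx₀ dρ - (1 - f) dρ²`.  Its contravariant components are
`g⁰⁰ = 2 - f`, `g^{0ρ} = f - 1`, `g^{ρρ} = - f`, `g^{φφ} = - ρ⁻²`, and `|det g|^{1/2} = ρ`. -/

/-- `f(ρ) = 1 - 2M/ρ + Q²/ρ²`, for a black hole of mass `M` and charge `Q`. -/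
def lapse (M Q ρ : ℝ) : ℝ := 1 - 2 * M / ρ + Q ^ 2 / ρ ^ 2

/-- The outer horizon. -/
def rPlus (M Q : ℝ) : ℝ := M + √(M ^ 2 - Q ^ 2)

/-- The inner horizon. -/
def rMinus (M Q : ℝ) : ℝ := M - √(M ^ 2 - Q ^ 2)

/-- Complex functions `u(x₀, ρ, φ)` on spacetime. -/
abbrev SpacetimeFun : Type := ℝ → ℝ → ℝ → ℂ

/-- The partial derivative in `x₀`. -/
def dTime (u : SpacetimeFun) : SpacetimeFun := fun t ρ φ => deriv (fun s => u s ρ φ) t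

/-- The partial derivative in `ρ`. -/
def dRad (u : SpacetimeFun) : SpacetimeFun := fun t ρ φ => deriv (fun r => u t r φ) ρ

/-- The partial derivative in `φ`. -/
def dAng (u : SpacetimeFun) : SpacetimeFun := fun t ρ φ => deriv (fun θ => u t ρ θ) φ

/-- The wave operator `□_g u = |g|^{-1/2} ∑_{j,k} ∂_j (|g|^{1/2} g^{jk} ∂_k u)`. -/
def waveOp (M Q : ℝ) (u : SpacetimeFun) : SpacetimeFun := fun t ρ φ =>
  dTime (fun s r θ => (2 - lapse M Q r) * dTime u s r θ + (lapse M Q r - 1) * dRad u s r θ) t ρ φ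
  + 1 / ρ * dRad (fun s r θ =>
      r * ((lapse M Q r - 1) * dTime u s r θ - lapse M Q r * dRad u s r θ)) t ρ φ
  - 1 / ρ ^ 2 * dAng (dAng u) t ρ φ

/-- `u` is a function of the polar angle that is a (twice continuously differentiable) solution
of the wave equation in a spacetime neighbourhood of the exterior part `x₀ = 0`, `ρ > r₊` of the
initial slice. -/
structure IsExteriorSolution (M Q : ℝ) (u : SpacetimeFun) : Prop where
  periodic : ∀ t ρ φ, u t ρ (φ + 2 * Real.pi) = u t ρ φ
  solves : ∃ U : Set (ℝ × ℝ × ℝ), IsOpen U ∧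
    (∀ ρ φ, rPlus M Q < ρ → ((0 : ℝ), ρ, φ) ∈ U) ∧
    ContDiffOn ℝ 2 (fun p : ℝ × ℝ × ℝ => u p.1 p.2.1 p.2.2) U ∧
    ∀ p ∈ U, waveOp M Q u p.1 p.2.1 p.2.2 = 0

/-- The Klein-Gordon inner product
`i ∫_{x₀ = t} |g|^{1/2} ∑_j g^{0j} (ū ∂_j v - ∂_j ū v) dρ dφ`. -/
def kgInner (M Q t : ℝ) (u v : SpacetimeFun) : ℂ :=
  I * ∫ ρ in Ioi (0 : ℝ), ∫ φ in (0 : ℝ)..(2 * Real.pi),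
    ((2 - lapse M Q ρ : ℝ) * (conj (u t ρ φ) * dTime v t ρ φ - conj (dTime u t ρ φ) * v t ρ φ)
      + (lapse M Q ρ - 1 : ℝ) *
        (conj (u t ρ φ) * dRad v t ρ φ - conj (dRad u t ρ φ) * v t ρ φ)) * (ρ : ℂ)

/-! ### The modes -/

/-- `γ_k`, for `k = (η, m')`. -/
def gammaMode (a η ρ : ℝ) : ℝ :=
  1 / (√ρ * (η ^ 2 + a ^ 2) ^ (1 / 4 : ℝ)) * (1 / (√2 * (2 * Real.pi)))

/-- `λ₀⁺(k)`. -/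
def lambdaPlus (M Q a η ρ : ℝ) : ℝ :=
  (-(lapse M Q ρ - 1) * η + √(η ^ 2 + a ^ 2)) / (2 - lapse M Q ρ)

/-- `λ₀⁻(k)`. -/
def lambdaMinus (M Q a η ρ : ℝ) : ℝ :=
  (-(lapse M Q ρ - 1) * η - √(η ^ 2 + a ^ 2)) / (2 - lapse M Q ρ)

/-- `γ_k e^{i k·x}` with `k·x = ρ η + m' φ`. -/
def modeData (a η : ℝ) (m' : ℤ) (ρ φ : ℝ) : ℂ :=
  gammaMode a η ρ * cexp (I * (ρ * η + m' * φ))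

/-- `fp η m'` and `fm η m'` are the modes `f_k⁺` and `f_k⁻`, `k = (η, m')`: the solutions of the
wave equation with the values `γ_k e^{ik·x}` and the time derivatives
`i λ₀^∓(k) γ_k e^{ik·x}` at `x₀ = 0`. -/
structure IsModeSystem (M Q a : ℝ) (fp fm : ℝ → ℤ → SpacetimeFun) : Prop where
  solution_plus : ∀ η m', IsExteriorSolution M Q (fp η m')
  solution_minus : ∀ η m', IsExteriorSolution M Q (fm η m')
  value_plus : ∀ η m' ρ φ, rPlus M Q < ρ → fp η m' 0 ρ φ = modeData a η m' ρ φ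
  value_minus : ∀ η m' ρ φ, rPlus M Q < ρ → fm η m' 0 ρ φ = modeData a η m' ρ φ
  velocity_plus : ∀ η m' ρ φ, rPlus M Q < ρ →
    HasDerivAt (fun t => fp η m' t ρ φ) (I * lambdaMinus M Q a η ρ * modeData a η m' ρ φ) 0
  velocity_minus : ∀ η m' ρ φ, rPlus M Q < ρ →
    HasDerivAt (fun t => fm η m' t ρ φ) (I * lambdaPlus M Q a η ρ * modeData a η m' ρ φ) 0

/-- Mode labels `k = (η, m')`. -/
abbrev ModeIndex : Type := ℝ × ℤ

/-- `∫ · dk` means `∑_{m'} ∫ · dη`. -/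
def modeMeasure : Measure ModeIndex := (volume : Measure ℝ).prod Measure.count

/-- The coefficient `C⁺(k) = <f_k⁺, C>`. -/
def coeffPlus (M Q : ℝ) (fp : ℝ → ℤ → SpacetimeFun) (C : SpacetimeFun) (k : ModeIndex) : ℂ :=
  kgInner M Q 0 (fp k.1 k.2) C

/-- The coefficient `C⁻(k) = - <f_{-k}⁻, C>`. -/
def coeffMinus (M Q : ℝ) (fm : ℝ → ℤ → SpacetimeFun) (C : SpacetimeFun) (k : ModeIndex) : ℂ :=
  -kgInner M Q 0 (fm (-k.1) (-k.2)) C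

/-! ### The wave packet -/

/-- `ξ̂₀ = 2 η₀ r₊² / (r₊ - r₋)`. -/
def xiHat (M Q η₀ : ℝ) : ℝ := 2 * η₀ * rPlus M Q ^ 2 / (rPlus M Q - rMinus M Q)

/-- `β̂ = - f (ξ̂₀ / (ρ - r₊)) / (2 - f)`. -/
def betaHat (M Q η₀ ρ : ℝ) : ℝ :=
  -lapse M Q ρ * (xiHat M Q η₀ / (ρ - rPlus M Q)) / (2 - lapse M Q ρ)

open Classical in
/-- The initial value
`θ(ρ - r₊) ρ^{-1/2} (ρ - r₊)^ε e^{-a(ρ - r₊)} exp (i ξ̂₀ ln|ρ - r₊| + i m φ)`. -/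
def packetData (M Q ε η₀ : ℝ) (m : ℤ) (a ρ φ : ℝ) : ℂ :=
  if rPlus M Q < ρ then
    ((1 / √ρ * (ρ - rPlus M Q) ^ ε * Real.exp (-a * (ρ - rPlus M Q)) : ℝ) : ℂ) *
      cexp (I * (xiHat M Q η₀ * Real.log |ρ - rPlus M Q|) + I * (m * φ))
  else 0

/-- `C` is the wave packet `Ĉ`: the solution of the wave equation with the initial data
`packetData` and `i β̂ · packetData`. -/
structure IsWavePacket (M Q ε η₀ : ℝ) (m : ℤ) (a : ℝ) (C : SpacetimeFun) : Prop where
  solution : IsExteriorSolution M Q C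
  value : ∀ ρ φ, 0 < ρ → C 0 ρ φ = packetData M Q ε η₀ m a ρ φ
  velocity : ∀ ρ φ, 0 < ρ →
    HasDerivAt (fun t => C t ρ φ) (I * betaHat M Q η₀ ρ * packetData M Q ε η₀ m a ρ φ) 0

/-- `C_n = C / <C, C>^{1/2}`. -/
def normalized (M Q : ℝ) (C : SpacetimeFun) : SpacetimeFun := fun t ρ φ =>
  C t ρ φ / (√(kgInner M Q 0 C C).re : ℝ)

/-! ### The quantum field -/

/-- A representation of the annihilation operators `α_k⁺` and the creation operators `α_{-k}⁻` of
the field `Φ = ∫ (α_k⁺ f_k⁺ + α_{-k}⁻ f_{-k}⁻) dk` on a complex vector space with a hermitian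
form.  The operators are smeared with square integrable functions `g` of `k`:
`annih g = ∫ conj (g k) α_k⁺ dk` and `creat g = ∫ g k α_{-k}⁻ dk`, so that
`[α_k⁺, α_{-k'}⁻] = δ(k - k')` reads `[annih g, creat h] = ⟪g, h⟫`.  The form is not required to
be positive: no vector of a positive definite space is an Unruh-type vacuum. -/
structure FieldRep : Type (u + 1) where
  /-- The space of states. -/
  V : Type u
  [addCommGroup : AddCommGroup V]
  [module : Module ℂ V]
  /-- The product `⟨x|y⟩` of states. -/
  form : V →ₗ⋆[ℂ] V →ₗ[ℂ] ℂ
  form_symm : ∀ x y, conj (form x y) = form y x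
  /-- Smeared annihilation operators. -/
  annih : Lp ℂ 2 modeMeasure →ₗ⋆[ℂ] Module.End ℂ V
  /-- Smeared creation operators. -/
  creat : Lp ℂ 2 modeMeasure →ₗ[ℂ] Module.End ℂ V
  adjoint : ∀ g x y, form (annih g x) y = form x (creat g y)
  annih_comm : ∀ g h, Commute (annih g) (annih h)
  creat_comm : ∀ g h, Commute (creat g) (creat h)
  ccr : ∀ g h, annih g * creat h - creat h * annih g = inner ℂ g h • (1 : Module.End ℂ V)

attribute [instance] FieldRep.addCommGroup FieldRep.module

open Classical in
/-- A square integrable function of `k` as an element of `L²` (and `0` for other functions). -/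
def toL2 (g : ModeIndex → ℂ) : Lp ℂ 2 modeMeasure :=
  if h : MemLp g 2 modeMeasure then h.toLp g else 0

namespace FieldRep

variable (F : FieldRep.{u})

/-- `Ψ` is a normalized Unruh-type vacuum: `α_k⁺ Ψ = 0` for `η > 0` (that is `α_k⁺⁺ Ψ = 0`) and
`α_{-k}⁻ Ψ = 0` for `η < 0` (that is `α_{-k}⁻⁻ Ψ = 0`), where `k = (η, m')`. -/
structure IsUnruhVacuum (Ψ : F.V) : Prop where
  norm_one : F.form Ψ Ψ = 1
  annih_eq_zero : ∀ g : Lp ℂ 2 modeMeasure,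
    (∀ᵐ k ∂modeMeasure, k.1 ≤ 0 → g k = 0) → F.annih g Ψ = 0
  creat_eq_zero : ∀ g : Lp ℂ 2 modeMeasure,
    (∀ᵐ k ∂modeMeasure, 0 ≤ k.1 → g k = 0) → F.creat g Ψ = 0

/-- `<C, Φ> = ∫ (<C, f_k⁺> α_k⁺ + <C, f_{-k}⁻> α_{-k}⁻) dk
= ∫ (conj (C⁺ k) α_k⁺ - conj (C⁻ k) α_{-k}⁻) dk`. -/
def pairing (cp cm : ModeIndex → ℂ) : Module.End ℂ F.V :=
  F.annih (toL2 cp) - F.creat (toL2 fun k => conj (cm k))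

/-- The adjoint `<C, Φ>^*` with respect to the form. -/
def pairingStar (cp cm : ModeIndex → ℂ) : Module.End ℂ F.V :=
  F.creat (toL2 cp) - F.annih (toL2 fun k => conj (cm k))

/-- The number operator `N(C) = <C, Φ>^* <C, Φ>`. -/
def numberOp (cp cm : ModeIndex → ℂ) : Module.End ℂ F.V :=
  F.pairingStar cp cm * F.pairing cp cm

end FieldRep

/-! ### The limit -/

/-- `Γ₁ = e^{π ξ / 2} Γ(i ξ + ε)`, that is
`Γ(i ξ + ε + 1) = (i ξ + ε) e^{- π ξ / 2} Γ₁`. -/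
def gammaOne (ε ξ : ℝ) : ℂ := Real.exp (Real.pi * ξ / 2) * Complex.Gamma (I * ξ + ε)

/-- The Hawking-type formula. -/
def hawkingUnruh (ε ξ : ℝ) : ℝ :=
  2 ^ (2 * ε) * Real.exp (-2 * Real.pi * ξ) * ‖gammaOne ε ξ‖ ^ 2
      / (2 * Real.pi * Real.Gamma (2 * ε))
    * ((ξ ^ 2 + ε ^ 2) / ξ)
    * ∫ η in Iio (0 : ℝ),
        |η| / (η ^ 2 + 1) ^ (ε + 1) * Real.exp (2 * ξ * Real.arcsin (1 / √(η ^ 2 + 1)))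

end RN

end

/-! The canonical commutation relation decides the expectation value. Let $\Psi$ be an Unruh-type
vacuum. For $\eta>0$ the vector $\alpha^-_{-k}\Psi$ has positive norm; for $\eta<0$ the relation
forces $\alpha^+_k\Psi$ to have negative norm. Hence $\langle
N(C)\rangle=\int_{\eta>0}|C^-|^2-\int_{\eta<0}|C^+|^2$ in every representation (`form_numberOp`).
Existence comes from the algebraic Fock space (polynomials) over a one-particle space whose form is
positive on the modes $\eta>0$ and negative on the conjugated modes $\eta\le0$.

Put $s=\rho-r_+$, $z=\varepsilon+i\hat\xi_0$, $R=\sqrt{\eta^2+a^2}$ and $f=s\,q(s)$. The integrand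
of a mode-packet product is $s^ze^{-(a+i\eta)s}$ times $\sigma iR-z/s+a+q(s)(\varepsilon-as)$, with
$\sigma=-1$ for $C^+$ and $\sigma=+1$ for $C^-$ (`kgInner_mode`). One integration by parts absorbs
$z/s$ and leaves $\Gamma(z+1)(a+i\eta)^{-(z+1)}\,i(\sigma R-\eta)$ plus a remainder that alone
contains $q$ (`overlap_eq`).

After $\eta\mapsto-\eta$ in the $C^-$ integral, both integrals run over $\eta<0$. In the difference
of squares the square of the remainder cancels, and a main term $-4\eta
R\,|\Gamma(z+1)(a+i\eta)^{-(z+1)}|^2$ and a cross term survive (`overlap_norm_sq_sub`). The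
substitution $\eta\mapsto a\eta$ shows that the main integral is exactly proportional to
$a^{-2\varepsilon}$ (`integral_overlapMain`), and so is $\langle\hat C,\hat C\rangle$
(`kgInner_self`). The cross term is smaller by a factor $O(1/a)$ (`integral_overlapCross_le`),
because the packet concentrates at the horizon. The lapse therefore drops out of the limit and only
$\hat\xi_0$ remains. The exponential factors come from
$|(a+i\eta)^{-i\hat\xi_0}|=e^{\hat\xi_0\arg(a+i\eta)}$. -/

/-! ### The Fock space of a hermitian form -/

namespace RN.Fock

variable {ι W : Type*} [AddCommGroup W] [Module ℂ W] (b : Module.Basis ι ℂ W)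
  (B : W →ₗ⋆[ℂ] W →ₗ[ℂ] ℂ)

/-- The embedding of the one-particle space in the polynomial Fock space. -/
noncomputable def oneParticle : W →ₗ[ℂ] MvPolynomial ι ℂ := b.constr ℂ MvPolynomial.X

@[simp] theorem oneParticle_basis (i : ι) : oneParticle b (b i) = MvPolynomial.X i := by
  simp [oneParticle]

/-- The creation operators: multiplication by one-particle vectors. -/
noncomputable def creation : W →ₗ[ℂ] Module.End ℂ (MvPolynomial ι ℂ) :=
  LinearMap.mul ℂ (MvPolynomial ι ℂ) ∘ₗ oneParticle b

theorem creation_apply (w : W) (p : MvPolynomial ι ℂ) :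
    creation b w p = oneParticle b w * p := rfl

/-- The derivation of the polynomial Fock space that contracts with `w`. -/
noncomputable def contraction (w : W) :
    Derivation ℂ (MvPolynomial ι ℂ) (MvPolynomial ι ℂ) :=
  MvPolynomial.mkDerivation ℂ fun i => MvPolynomial.C (B w (b i))

@[simp] theorem contraction_X (w : W) (i : ι) :
    contraction b B w (MvPolynomial.X i) = MvPolynomial.C (B w (b i)) := by
  simp [contraction]

/-- The annihilation operators: contraction with one-particle vectors. -/
noncomputable def annihilation : W →ₗ⋆[ℂ] Module.End ℂ (MvPolynomial ι ℂ) where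
  toFun w := (contraction b B w : MvPolynomial ι ℂ →ₗ[ℂ] MvPolynomial ι ℂ)
  map_add' v w := by
    rw [← Derivation.coe_add_linearMap]
    congr 1
    exact MvPolynomial.derivation_ext fun i => by simp
  map_smul' c w := by
    rw [← Derivation.coe_smul_linearMap]
    congr 1
    exact MvPolynomial.derivation_ext fun i => by simp [MvPolynomial.smul_eq_C_mul]

theorem annihilation_apply (w : W) (p : MvPolynomial ι ℂ) :
    annihilation b B w p = contraction b B w p := rfl

theorem contraction_oneParticle (v w : W) :
    contraction b B v (oneParticle b w) = MvPolynomial.C (B v w) := by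
  have h : (contraction b B v : MvPolynomial ι ℂ →ₗ[ℂ] MvPolynomial ι ℂ) ∘ₗ oneParticle b
      = (Algebra.linearMap ℂ (MvPolynomial ι ℂ)) ∘ₗ B v :=
    b.ext fun i => by simp [MvPolynomial.algebraMap_eq]
  exact LinearMap.congr_fun h w

theorem annihilation_commute (v w : W) :
    Commute (annihilation b B v) (annihilation b B w) := by
  have h : ⁅contraction b B v, contraction b B w⁆ = 0 :=
    MvPolynomial.derivation_ext fun i => by simp [Derivation.commutator_apply]
  refine LinearMap.ext fun p => ?_
  have := congrArg (fun D => D p) h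
  simpa [Derivation.commutator_apply, sub_eq_zero, annihilation_apply] using this

theorem creation_commute (v w : W) : Commute (creation b v) (creation b w) :=
  LinearMap.ext fun p => by simp [creation_apply, mul_left_comm]

theorem annihilation_mul_creation (v w : W) :
    annihilation b B v * creation b w
      = creation b w * annihilation b B v + B v w • (1 : Module.End ℂ (MvPolynomial ι ℂ)) := by
  refine LinearMap.ext fun p => ?_
  simp only [creation_apply, annihilation_apply, contraction_oneParticle, Module.End.mul_apply,
    Derivation.leibniz, smul_eq_mul, LinearMap.add_apply, LinearMap.smul_apply,
    Module.End.one_apply, MvPolynomial.smul_eq_C_mul]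
  ring

/-- The conjugate-linear extension of `annihilation` to polynomials. -/
theorem exists_contractionHom : ∃ D : MvPolynomial ι ℂ →+* Module.End ℂ (MvPolynomial ι ℂ),
    (∀ c, D (MvPolynomial.C c) = conj c • 1) ∧
      ∀ i, D (MvPolynomial.X i) = annihilation b B (b i) := by
  have hcomm : ∀ x ∈ range (fun i => annihilation b B (b i)),
      ∀ y ∈ range (fun i => annihilation b B (b i)), x * y = y * x := by
    rintro _ ⟨i, rfl⟩ _ ⟨j, rfl⟩
    exact annihilation_commute b B _ _
  -- Evaluation of polynomials needs a commutative target. The contractions commute, so the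
  -- subalgebra that they generate serves as one.
  have hc := Algebra.isMulCommutative_adjoin ℂ hcomm
  let : CommRing (Algebra.adjoin ℂ (range fun i => annihilation b B (b i))) :=
    { (inferInstance : Ring (Algebra.adjoin ℂ (range fun i => annihilation b B (b i)))) with
      mul_comm := hc.is_comm.comm }
  let g : ι → Algebra.adjoin ℂ (range fun i => annihilation b B (b i)) :=
    fun i => ⟨annihilation b B (b i), Algebra.subset_adjoin ⟨i, rfl⟩⟩
  refine ⟨(Algebra.adjoin ℂ (range fun i => annihilation b B (b i))).val.toRingHom.comp
    (MvPolynomial.eval₂Hom ((algebraMap ℂ _).comp (starRingEnd ℂ)) g), fun c => ?_, fun i => ?_⟩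
  · simp [Algebra.algebraMap_eq_smul_one]
  · simp [g]

/-- Its value at `p` is to be the adjoint of multiplication by `p`, which is why it is
multiplicative and conjugate-linear. -/
noncomputable def contractionHom : MvPolynomial ι ℂ →+* Module.End ℂ (MvPolynomial ι ℂ) :=
  (exists_contractionHom b B).choose

@[simp] theorem contractionHom_C (c : ℂ) :
    contractionHom b B (MvPolynomial.C c) = conj c • 1 :=
  (exists_contractionHom b B).choose_spec.1 c

@[simp] theorem contractionHom_X (i : ι) :
    contractionHom b B (MvPolynomial.X i) = annihilation b B (b i) :=
  (exists_contractionHom b B).choose_spec.2 i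

theorem contractionHom_smul (c : ℂ) (p : MvPolynomial ι ℂ) :
    contractionHom b B (c • p) = conj c • contractionHom b B p := by
  rw [MvPolynomial.smul_eq_C_mul, map_mul, contractionHom_C, smul_mul_assoc, one_mul]

theorem contractionHom_oneParticle (w : W) :
    contractionHom b B (oneParticle b w) = annihilation b B w := by
  let D : MvPolynomial ι ℂ →ₗ⋆[ℂ] Module.End ℂ (MvPolynomial ι ℂ) :=
    { toFun := contractionHom b B
      map_add' := map_add _
      map_smul' := contractionHom_smul b B }
  have h : D.comp (oneParticle b) = annihilation b B := b.ext fun i => by simp [D]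
  exact LinearMap.congr_fun h w

/-- The commutation relation iterated over the factors of `p`: moving a creation operator past them
contracts it with each in turn. Hermiticity of `B` identifies these contractions with the derivation
of `p` along `w`, because `contractionHom` conjugates scalars. -/
theorem contractionHom_commutator (hB : ∀ v w, conj (B v w) = B w v) (w : W)
    (p q : MvPolynomial ι ℂ) :
    contractionHom b B p (oneParticle b w * q)
      = oneParticle b w * contractionHom b B p q
        + contractionHom b B (contraction b B w p) q := by
  induction p using MvPolynomial.induction_on generalizing q with
  | C c => simp
  | add p₁ p₂ h₁ h₂ => simp [h₁, h₂, mul_add]; abel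
  | mul_X p i h =>
    have h₁ : contraction b B (b i) (oneParticle b w * q)
        = oneParticle b w * contraction b B (b i) q + B (b i) w • q := by
      rw [Derivation.leibniz, contraction_oneParticle, smul_eq_mul, smul_eq_mul,
        MvPolynomial.smul_eq_C_mul, mul_comm q]
    have h₂ : contractionHom b B (contraction b B w (p * MvPolynomial.X i)) q
        = B (b i) w • contractionHom b B p q
          + contractionHom b B (contraction b B w p) (contraction b B (b i) q) := by
      rw [Derivation.leibniz, contraction_X, smul_eq_mul, smul_eq_mul,
        mul_comm (MvPolynomial.X i), mul_comm p, ← MvPolynomial.smul_eq_C_mul, map_add, map_mul,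
        contractionHom_smul, hB, contractionHom_X]
      rfl
    rw [h₂, map_mul (contractionHom b B), contractionHom_X, Module.End.mul_apply, Module.End.mul_apply,
      annihilation_apply, annihilation_apply, h₁, map_add, h, map_smul]
    abel

/-- The hermitian form of the Fock space. -/
noncomputable def form : MvPolynomial ι ℂ →ₗ⋆[ℂ] MvPolynomial ι ℂ →ₗ[ℂ] ℂ :=
  LinearMap.mk₂'ₛₗ (starRingEnd ℂ) (RingHom.id ℂ)
    (fun p q => MvPolynomial.constantCoeff (contractionHom b B p q))
    (fun p p' q => by simp) (fun c p q => by simp [contractionHom_smul])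
    (fun p q q' => by simp) (fun c p q => by simp)

theorem form_apply (p q : MvPolynomial ι ℂ) :
    form b B p q = MvPolynomial.constantCoeff (contractionHom b B p q) := rfl

theorem constantCoeff_oneParticle (w : W) :
    MvPolynomial.constantCoeff (oneParticle b w) = 0 := by
  have h : (MvPolynomial.lcoeff ℂ (0 : ι →₀ ℕ)) ∘ₗ oneParticle b = 0 :=
    b.ext fun i => by simp
  simpa [MvPolynomial.constantCoeff_eq] using LinearMap.congr_fun h w

theorem form_creation_left (w : W) (p q : MvPolynomial ι ℂ) :
    form b B (creation b w p) q = form b B p (annihilation b B w q) := by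
  rw [form_apply, form_apply, creation_apply, mul_comm, map_mul, contractionHom_oneParticle]
  rfl

/-- In `contractionHom_commutator` the term with the factor `oneParticle b w` has no constant
coefficient, so only the contraction of `p` survives. -/
theorem form_annihilation_left (hB : ∀ v w, conj (B v w) = B w v) (w : W)
    (p q : MvPolynomial ι ℂ) :
    form b B (annihilation b B w p) q = form b B p (creation b w q) := by
  rw [form_apply, form_apply, creation_apply, contractionHom_commutator b B hB]
  simp [constantCoeff_oneParticle, annihilation_apply]

theorem form_one_left (q : MvPolynomial ι ℂ) :
    form b B 1 q = MvPolynomial.constantCoeff q := by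
  simp [form_apply]

theorem annihilation_one (w : W) : annihilation b B w 1 = 0 := by
  simp [annihilation_apply]

theorem form_one_right (p : MvPolynomial ι ℂ) :
    form b B p 1 = conj (MvPolynomial.constantCoeff p) := by
  induction p using MvPolynomial.induction_on with
  | C c => simp [form_apply]
  | add p q hp hq => simp [hp, hq]
  | mul_X p i _ => simp [form_apply, annihilation_one]

/-- Both adjointness relations move a variable from one side to the other, so induction on the first
argument reduces to constants. -/
theorem conj_form (hB : ∀ v w, conj (B v w) = B w v) (p q : MvPolynomial ι ℂ) :
    conj (form b B p q) = form b B q p := by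
  induction p using MvPolynomial.induction_on generalizing q with
  | C c =>
    have : (MvPolynomial.C c : MvPolynomial ι ℂ) = c • 1 := by
      rw [MvPolynomial.smul_eq_C_mul, mul_one]
    simp [this, form_one_left, form_one_right]
  | add p₁ p₂ h₁ h₂ => simp [h₁, h₂]
  | mul_X p i h =>
    have : p * MvPolynomial.X i = creation b (b i) p := by simp [creation_apply, mul_comm]
    rw [this, form_creation_left, h, form_annihilation_left b B hB]

end RN.Fock

/-! ### A representation with an Unruh-type vacuum -/

namespace RN

/-- The modes with `η > 0`. -/
def posModes : Set ModeIndex := {k | 0 < k.1}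

theorem measurableSet_posModes : MeasurableSet posModes :=
  measurableSet_lt measurable_const measurable_fst

/-- The restriction of square integrable functions of `k` to a set. -/
noncomputable def restrictModes (s : Set ModeIndex) :
    Lp ℂ 2 modeMeasure →ₗ[ℂ] Lp ℂ 2 (modeMeasure.restrict s) :=
  (LpToLpRestrictCLM ModeIndex ℂ ℂ modeMeasure 2 s).toLinearMap

theorem restrictModes_coeFn (s : Set ModeIndex) (g : Lp ℂ 2 modeMeasure) :
    restrictModes s g =ᵐ[modeMeasure.restrict s] g :=
  LpToLpRestrictCLM_coeFn ℂ s g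

theorem inner_restrictModes_add (g h : Lp ℂ 2 modeMeasure) :
    inner ℂ (restrictModes posModes g) (restrictModes posModes h)
      + inner ℂ (restrictModes posModesᶜ g) (restrictModes posModesᶜ h) = inner ℂ g h := by
  have key : ∀ s : Set ModeIndex, inner ℂ (restrictModes s g) (restrictModes s h)
      = ∫ k in s, inner ℂ (g k) (h k) ∂modeMeasure := fun s => by
    rw [L2.inner_def]
    refine integral_congr_ae ?_
    filter_upwards [restrictModes_coeFn s g, restrictModes_coeFn s h] with k hg hh
    rw [hg, hh]
  rw [key, key, L2.inner_def]
  exact integral_add_compl measurableSet_posModes (L2.integrable_inner g h)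

theorem restrictModes_eq_zero {s : Set ModeIndex} (hs : MeasurableSet s)
    {g : Lp ℂ 2 modeMeasure} (h : ∀ᵐ k ∂modeMeasure, k ∈ s → g k = 0) :
    restrictModes s g = 0 := by
  refine (Lp.eq_zero_iff_ae_eq_zero).2 ?_
  filter_upwards [restrictModes_coeFn s g, (ae_restrict_iff' hs).2 h] with k h₁ h₂
  rw [h₁, h₂]; rfl

/-- Complex conjugation of square integrable functions. -/
noncomputable def conjL2 {α : Type*} [MeasurableSpace α] (μ : Measure α) :
    Lp ℂ 2 μ →ₗ⋆[ℂ] Lp ℂ 2 μ where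
  toFun := star
  map_add' f g := Lp.ext <| by
    filter_upwards [Lp.coeFn_star (f + g), Lp.coeFn_add f g, Lp.coeFn_star f, Lp.coeFn_star g,
      Lp.coeFn_add (star f) (star g)] with x h₁ h₂ h₃ h₄ h₅
    rw [h₁, h₅, Pi.star_apply, h₂, Pi.add_apply, Pi.add_apply, h₃, h₄, star_add]
    rfl
  map_smul' c f := Lp.ext <| by
    filter_upwards [Lp.coeFn_star (c • f), Lp.coeFn_smul c f, Lp.coeFn_star f,
      Lp.coeFn_smul (conj c) (star f)] with x h₁ h₂ h₃ h₄
    simp [h₁, h₂, h₃, h₄]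

/-- Conjugation is needed because `annih` is conjugate-linear while Fock creation operators are
linear. The exchange of arguments matches the order in which the commutator produces them. -/
theorem inner_conjL2 {α : Type*} [MeasurableSpace α] (μ : Measure α) (f g : Lp ℂ 2 μ) :
    inner ℂ (conjL2 μ f) (conjL2 μ g) = inner ℂ g f := by
  rw [L2.inner_def, L2.inner_def]
  refine integral_congr_ae ?_
  filter_upwards [Lp.coeFn_star f, Lp.coeFn_star g] with x h₁ h₂
  change inner ℂ ((star f : Lp ℂ 2 μ) x) ((star g : Lp ℂ 2 μ) x) = _
  rw [h₁, h₂]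
  simp [mul_comm]

/-- The one-particle space: modes with `η > 0` and (conjugated) modes with `η ≤ 0`. -/
abbrev OneParticle : Type :=
  Lp ℂ 2 (modeMeasure.restrict posModes) × Lp ℂ 2 (modeMeasure.restrict posModesᶜ)

/-- The indefinite form of the one-particle space. -/
noncomputable def oneParticleForm : OneParticle →ₗ⋆[ℂ] OneParticle →ₗ[ℂ] ℂ :=
  LinearMap.mk₂'ₛₗ (starRingEnd ℂ) (RingHom.id ℂ)
    (fun v w => inner ℂ v.1 w.1 - inner ℂ v.2 w.2)
    (fun v v' w => by simp only [Prod.fst_add, Prod.snd_add, inner_add_left]; ring)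
    (fun c v w => by
      simp only [Prod.smul_fst, Prod.smul_snd, inner_smul_left, smul_eq_mul]; ring)
    (fun v w w' => by simp only [Prod.fst_add, Prod.snd_add, inner_add_right]; ring)
    (fun c v w => by
      simp only [Prod.smul_fst, Prod.smul_snd, inner_smul_right, smul_eq_mul, RingHom.id_apply]
      ring)

theorem oneParticleForm_apply (v w : OneParticle) :
    oneParticleForm v w = inner ℂ v.1 w.1 - inner ℂ v.2 w.2 := rfl

theorem conj_oneParticleForm (v w : OneParticle) :
    conj (oneParticleForm v w) = oneParticleForm w v := by
  simp [oneParticleForm_apply]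

/-- The component of `g` that is carried by the modes with `η > 0`. -/
noncomputable def posPart : Lp ℂ 2 modeMeasure →ₗ[ℂ] OneParticle :=
  LinearMap.inl ℂ _ _ ∘ₗ restrictModes posModes

/-- The conjugate of the component of `g` that is carried by the modes with `η ≤ 0`. -/
noncomputable def negPart : Lp ℂ 2 modeMeasure →ₗ⋆[ℂ] OneParticle :=
  (LinearMap.inr ℂ _ _ ∘ₗ (LinearMap.id (R := ℂ))).comp
    ((conjL2 (modeMeasure.restrict posModesᶜ)).comp (restrictModes posModesᶜ))

theorem posPart_apply (g : Lp ℂ 2 modeMeasure) :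
    posPart g = (restrictModes posModes g, 0) := rfl

theorem negPart_apply (g : Lp ℂ 2 modeMeasure) :
    negPart g = (0, conjL2 _ (restrictModes posModesᶜ g)) := rfl

theorem oneParticleForm_posPart_negPart (g h : Lp ℂ 2 modeMeasure) :
    oneParticleForm (posPart g) (negPart h) = 0 := by
  simp [oneParticleForm_apply, posPart_apply, negPart_apply]

/-- The commutator of a creation with an annihilation operator carries a minus sign. The negative
form on the modes $\eta\le0$ compensates it, so that both halves add up to the full inner product.
-/
theorem oneParticleForm_parts (g h : Lp ℂ 2 modeMeasure) :
    oneParticleForm (posPart g) (posPart h) - oneParticleForm (negPart h) (negPart g)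
      = inner ℂ g h := by
  rw [← inner_restrictModes_add g h]
  simp [oneParticleForm_apply, posPart_apply, negPart_apply, inner_conjL2]

open Fock in
/-- The representation of the field on the Fock space of a hermitian form `B` whose modes are
distributed by `p` on annihilation operators and by `n` on creation operators. -/
noncomputable def fockRep {ι W : Type} [AddCommGroup W] [Module ℂ W] (b : Module.Basis ι ℂ W)
    (B : W →ₗ⋆[ℂ] W →ₗ[ℂ] ℂ) (hB : ∀ v w, conj (B v w) = B w v)
    (p : Lp ℂ 2 modeMeasure →ₗ[ℂ] W) (n : Lp ℂ 2 modeMeasure →ₗ⋆[ℂ] W)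
    (hpn : ∀ g h, B (p g) (n h) = 0)
    (hinner : ∀ g h, B (p g) (p h) - B (n h) (n g) = inner ℂ g h) : FieldRep.{0} where
  V := MvPolynomial ι ℂ
  form := form b B
  form_symm := conj_form b B hB
  annih := (annihilation b B).comp p + (creation b).comp n
  creat := (creation b).comp p + (annihilation b B).comp n
  adjoint g x y := by
    simp only [LinearMap.add_apply, LinearMap.comp_apply, map_add, form_creation_left,
      form_annihilation_left b B hB]
  annih_comm g h := by
    have h₁ := annihilation_mul_creation b B (p g) (n h)
    have h₂ := annihilation_mul_creation b B (p h) (n g)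
    -- Orthogonality of the two kinds of parts removes the scalar commutators between contractions
    -- along `p` and multiplications along `n`.
    rw [hpn, zero_smul, add_zero] at h₁ h₂
    exact ((annihilation_commute b B _ _).add_right h₁).add_left
      ((Commute.symm h₂).add_right (creation_commute b _ _))
  creat_comm g h := by
    have h₁ := annihilation_mul_creation b B (n g) (p h)
    have h₂ := annihilation_mul_creation b B (n h) (p g)
    -- Hermiticity reverses the arguments, so that the orthogonality `hpn` applies.
    rw [← hB, hpn, map_zero, zero_smul, add_zero] at h₁ h₂
    exact ((creation_commute b _ _).add_right (Commute.symm h₂)).add_left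
      (Commute.add_right h₁ (annihilation_commute b B _ _))
  ccr g h := by
    have h₁ := annihilation_mul_creation b B (p g) (p h)
    have h₂ := annihilation_mul_creation b B (n h) (n g)
    have h₃ := (annihilation_commute b B (p g) (n h)).eq
    have h₄ := (creation_commute b (n g) (p h)).eq
    have key : (annihilation b B (p g) + creation b (n g))
          * (creation b (p h) + annihilation b B (n h))
        - (creation b (p h) + annihilation b B (n h))
          * (annihilation b B (p g) + creation b (n g))
        = (inner ℂ g h : ℂ) • (1 : Module.End ℂ (MvPolynomial ι ℂ)) := by
      rw [sub_eq_iff_eq_add.1 (hinner g h)] at h₁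
      rw [add_smul] at h₁
      simp only [add_mul, mul_add, h₁, h₂, h₃, h₄]
      abel
    exact key

theorem exists_unruhVacuum : ∃ (F : FieldRep.{0}) (Ψ : F.V), F.IsUnruhVacuum Ψ := by
  refine ⟨fockRep (Module.Basis.ofVectorSpace ℂ OneParticle) oneParticleForm
      conj_oneParticleForm posPart negPart oneParticleForm_posPart_negPart oneParticleForm_parts,
    (1 : MvPolynomial (Module.Basis.ofVectorSpaceIndex ℂ OneParticle) ℂ),
    ?_, fun g hg => ?_, fun g hg => ?_⟩
  · exact (Fock.form_one_left _ _ _).trans (map_one _)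
  -- For `g` carried by $\eta>0$ the smeared annihilator is a pure contraction, and a derivation
  -- kills the constant polynomial `1`.
  · have h : negPart g = 0 := by
      rw [negPart_apply, restrictModes_eq_zero measurableSet_posModes.compl
        (hg.mono fun k hk hk' => hk (not_lt.1 hk')), map_zero]
      rfl
    change Fock.annihilation _ _ (posPart g) 1 + Fock.creation _ (negPart g) 1 = 0
    rw [h, Fock.annihilation_one, map_zero, zero_add]
    rfl
  · have h : posPart g = 0 := by
      rw [posPart_apply, restrictModes_eq_zero measurableSet_posModes
        (hg.mono fun k hk hk' => hk (le_of_lt hk'))]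
      rfl
    change Fock.creation _ (posPart g) 1 + Fock.annihilation _ _ (negPart g) 1 = 0
    rw [h, Fock.annihilation_one, map_zero, add_zero]
    rfl

/-! ### The vacuum expectation value of the number operator -/

theorem FieldRep.form_creat_right (F : FieldRep.{u}) (g : Lp ℂ 2 modeMeasure) (x y : F.V) :
    F.form x (F.creat g y) = F.form (F.annih g x) y := (F.adjoint g x y).symm

theorem FieldRep.form_annih_right (F : FieldRep.{u}) (g : Lp ℂ 2 modeMeasure) (x y : F.V) :
    F.form x (F.annih g y) = F.form (F.creat g x) y := by
  rw [← F.form_symm, F.adjoint, F.form_symm]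

/-- The expectation is the norm of `annih g₂ Ψ - creat h₁ Ψ`, since the other parts annihilate `Ψ`.
As `creat g₂ Ψ = 0`, the commutator gives `annih g₂ Ψ` the norm `-⟪g₂, g₂⟫`; as `annih h₁ Ψ = 0`, it
gives `creat h₁ Ψ` the norm `⟪h₁, h₁⟫`. The mixed products vanish because creation operators
commute. -/
theorem FieldRep.IsUnruhVacuum.form_normalOrder {F : FieldRep.{u}} {Ψ : F.V}
    (hΨ : F.IsUnruhVacuum Ψ) {g₁ g₂ h₁ h₂ : Lp ℂ 2 modeMeasure}
    (hg₁ : ∀ᵐ k ∂modeMeasure, k.1 ≤ 0 → g₁ k = 0) (hg₂ : ∀ᵐ k ∂modeMeasure, 0 ≤ k.1 → g₂ k = 0)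
    (hh₁ : ∀ᵐ k ∂modeMeasure, k.1 ≤ 0 → h₁ k = 0)
    (hh₂ : ∀ᵐ k ∂modeMeasure, 0 ≤ k.1 → h₂ k = 0) :
    F.form Ψ (((F.creat (g₁ + g₂) - F.annih (h₁ + h₂)) * (F.annih (g₁ + g₂) - F.creat (h₁ + h₂))) Ψ)
      = inner ℂ h₁ h₁ - inner ℂ g₂ g₂ := by
  have e₁ : F.annih (g₁ + g₂) Ψ = F.annih g₂ Ψ := by
    rw [map_add, LinearMap.add_apply, hΨ.annih_eq_zero g₁ hg₁, zero_add]
  have e₂ : F.creat (h₁ + h₂) Ψ = F.creat h₁ Ψ := by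
    rw [map_add, LinearMap.add_apply, hΨ.creat_eq_zero h₂ hh₂, add_zero]
  have a₁ : F.form (F.annih g₂ Ψ) (F.annih g₂ Ψ) = -inner ℂ g₂ g₂ := by
    have h := LinearMap.congr_fun (F.ccr g₂ g₂) Ψ
    simp only [LinearMap.sub_apply, Module.End.mul_apply, hΨ.creat_eq_zero g₂ hg₂, map_zero,
      zero_sub, LinearMap.smul_apply, Module.End.one_apply] at h
    rw [F.adjoint, eq_comm, neg_eq_iff_eq_neg, ← map_neg, h, map_smul, hΨ.norm_one, smul_eq_mul,
      mul_one]
  have a₂ : F.form (F.creat h₁ Ψ) (F.creat h₁ Ψ) = inner ℂ h₁ h₁ := by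
    have h := LinearMap.congr_fun (F.ccr h₁ h₁) Ψ
    simp only [LinearMap.sub_apply, Module.End.mul_apply, hΨ.annih_eq_zero h₁ hh₁, map_zero,
      sub_zero, LinearMap.smul_apply, Module.End.one_apply] at h
    rw [← F.form_annih_right, h, map_smul, hΨ.norm_one, smul_eq_mul, mul_one]
  have a₃ : F.form (F.annih g₂ Ψ) (F.creat h₁ Ψ) = 0 := by
    rw [F.adjoint, ← Module.End.mul_apply, (F.creat_comm g₂ h₁).eq, Module.End.mul_apply,
      hΨ.creat_eq_zero g₂ hg₂, map_zero, map_zero]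
  have a₄ : F.form (F.creat h₁ Ψ) (F.annih g₂ Ψ) = 0 := by
    rw [← F.form_symm, a₃, map_zero]
  rw [Module.End.mul_apply, LinearMap.sub_apply, map_sub, F.form_creat_right, F.form_annih_right,
    e₁, e₂, LinearMap.sub_apply, e₁, e₂, map_sub, map_sub, a₁, a₂, a₃, a₄]
  ring

theorem exists_toL2_eq_add {g : ModeIndex → ℂ} (hg : MemLp g 2 modeMeasure) :
    ∃ g₁ g₂ : Lp ℂ 2 modeMeasure, toL2 g = g₁ + g₂ ∧
      (∀ᵐ k ∂modeMeasure, k.1 ≤ 0 → g₁ k = 0) ∧ (∀ᵐ k ∂modeMeasure, 0 ≤ k.1 → g₂ k = 0) ∧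
      inner ℂ g₁ g₁ = ((∫ k in {k | 0 < k.1}, ‖g k‖ ^ 2 ∂modeMeasure : ℝ) : ℂ) ∧
      inner ℂ g₂ g₂ = ((∫ k in {k | k.1 < 0}, ‖g k‖ ^ 2 ∂modeMeasure : ℝ) : ℂ) := by
  have hs₁ : MeasurableSet {k : ModeIndex | 0 < k.1} := measurableSet_posModes
  have hs₂ : MeasurableSet {k : ModeIndex | k.1 < 0} :=
    measurableSet_lt measurable_fst measurable_const
  -- The modes with $\eta=0$ form a null set, so the two open half-spaces carry all of `g`.
  have hnull : ∀ᵐ k ∂modeMeasure, k.1 ≠ 0 :=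
    Measure.quasiMeasurePreserving_fst.ae (p := fun η : ℝ => η ≠ 0)
      (Measure.ae_ne volume (0 : ℝ))
  have key : ∀ s : Set ModeIndex, MeasurableSet s → ∀ hs : MemLp (s.indicator g) 2 modeMeasure,
      inner ℂ (hs.toLp _) (hs.toLp _) = ((∫ k in s, ‖g k‖ ^ 2 ∂modeMeasure : ℝ) : ℂ) := by
    intro s hms hs
    rw [L2.inner_def, ← integral_indicator hms, ← integral_complex_ofReal]
    refine integral_congr_ae ?_
    filter_upwards [hs.coeFn_toLp] with k hk
    rw [hk]
    by_cases h : k ∈ s <;> simp [h]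
  refine ⟨(hg.indicator hs₁).toLp _, (hg.indicator hs₂).toLp _, ?_, ?_, ?_, key _ hs₁ _,
    key _ hs₂ _⟩
  · rw [toL2, dif_pos hg, ← MemLp.toLp_add]
    refine MemLp.toLp_congr _ _ ?_
    filter_upwards [hnull] with k hk
    rcases lt_or_gt_of_ne hk with h | h
    · simp [h, h.le]
    · simp [h, h.le]
  · filter_upwards [(hg.indicator hs₁).coeFn_toLp] with k hk h
    rw [hk, indicator_of_notMem]
    simpa using h
  · filter_upwards [(hg.indicator hs₂).coeFn_toLp] with k hk h
    rw [hk, indicator_of_notMem]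
    simpa using h

theorem FieldRep.IsUnruhVacuum.form_numberOp {F : FieldRep.{u}} {Ψ : F.V}
    (hΨ : F.IsUnruhVacuum Ψ) {cp cm : ModeIndex → ℂ} (hcp : MemLp cp 2 modeMeasure)
    (hcm : MemLp cm 2 modeMeasure) :
    F.form Ψ (F.numberOp cp cm Ψ)
      = (((∫ k in {k | 0 < k.1}, ‖cm k‖ ^ 2 ∂modeMeasure)
          - ∫ k in {k | k.1 < 0}, ‖cp k‖ ^ 2 ∂modeMeasure : ℝ) : ℂ) := by
  obtain ⟨g₁, g₂, hg, hg₁, hg₂, -, hg'⟩ := exists_toL2_eq_add hcp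
  obtain ⟨h₁, h₂, hh, hh₁, hh₂, hh', -⟩ := exists_toL2_eq_add hcm.star
  have hh₀ : toL2 (fun k => conj (cm k)) = h₁ + h₂ := hh
  rw [FieldRep.numberOp, FieldRep.pairing, FieldRep.pairingStar, hg, hh₀,
    hΨ.form_normalOrder hg₁ hg₂ hh₁ hh₂, hg', hh']
  simp

end RN

/-! ### Geometry of the exterior -/

namespace RN

theorem rPlus_pos {M Q : ℝ} (hM : 0 < M) : 0 < rPlus M Q := by
  unfold rPlus; positivity

theorem rMinus_lt_rPlus {M Q : ℝ} (hQ : Q ^ 2 < M ^ 2) : rMinus M Q < rPlus M Q := by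
  have : 0 < √(M ^ 2 - Q ^ 2) := Real.sqrt_pos.2 (sub_pos.2 hQ)
  unfold rMinus rPlus; linarith

theorem rMinus_nonneg {M Q : ℝ} (hM : 0 < M) : 0 ≤ rMinus M Q := by
  have : √(M ^ 2 - Q ^ 2) ≤ M := by
    rw [Real.sqrt_le_left hM.le]; nlinarith [sq_nonneg Q]
  unfold rMinus; linarith

theorem rPlus_add_rMinus (M Q : ℝ) : rPlus M Q + rMinus M Q = 2 * M := by
  unfold rMinus rPlus; ring

theorem rPlus_mul_rMinus {M Q : ℝ} (hQ : Q ^ 2 < M ^ 2) : rPlus M Q * rMinus M Q = Q ^ 2 := by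
  have := Real.sq_sqrt (sub_pos.2 hQ).le
  unfold rMinus rPlus; linear_combination -this

/-- The function `q` with `f(r₊ + s) = s q(s)`. -/
noncomputable def lapseQuot (M Q s : ℝ) : ℝ :=
  (s + (rPlus M Q - rMinus M Q)) / (s + rPlus M Q) ^ 2

theorem lapse_eq {M Q : ℝ} (hM : 0 < M) (hQ : Q ^ 2 < M ^ 2) {ρ : ℝ} (hρ : rPlus M Q < ρ) :
    lapse M Q ρ = (ρ - rPlus M Q) * lapseQuot M Q (ρ - rPlus M Q) := by
  have h₀ : ρ ≠ 0 := ((rPlus_pos hM).trans hρ).ne'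
  rw [lapse, lapseQuot, ← rPlus_mul_rMinus hQ, ← rPlus_add_rMinus M Q, sub_add_cancel]
  field_simp
  ring

/-- Here $f=(\rho-r_+)(\rho-r_-)/\rho^2\le1$ because $r_\pm\ge0$. This allows the denominators of
$\lambda_0^\pm$ and $\hat\beta$ to be cleared. -/
theorem two_sub_lapse_pos {M Q : ℝ} (hM : 0 < M) (hQ : Q ^ 2 < M ^ 2) {ρ : ℝ}
    (hρ : rPlus M Q < ρ) : 0 < 2 - lapse M Q ρ := by
  have h₀ : 0 < ρ := (rPlus_pos hM).trans hρ
  have h₁ := rPlus_pos (Q := Q) hM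
  have h₂ := rMinus_nonneg (Q := Q) hM
  have h₃ : lapse M Q ρ ≤ 1 := by
    rw [lapse_eq hM hQ hρ, lapseQuot, sub_add_cancel, mul_div_assoc', div_le_one (by positivity)]
    nlinarith
  linarith

theorem xiHat_pos {M Q η₀ : ℝ} (hM : 0 < M) (hQ : Q ^ 2 < M ^ 2) (hη₀ : 0 < η₀) :
    0 < xiHat M Q η₀ := by
  have := rPlus_pos (Q := Q) hM
  have := sub_pos.2 (rMinus_lt_rPlus hQ)
  unfold xiHat; positivity

/-! ### Initial data in exponential form -/

theorem one_div_sqrt_eq_exp {ρ : ℝ} (hρ : 0 < ρ) :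
    ((1 / √ρ : ℝ) : ℂ) = cexp (-(1 / 2) * Real.log ρ) := by
  rw [Real.sqrt_eq_rpow, one_div, ← Real.rpow_neg hρ.le, Real.rpow_def_of_pos hρ]
  push_cast
  congr 1; ring

/-- The exponent of the initial value of the wave packet. -/
noncomputable def packetPhase (r a : ℝ) (z : ℂ) (m : ℤ) (φ ρ : ℝ) : ℂ :=
  -(1 / 2) * Real.log ρ + z * Real.log (ρ - r) - a * (ρ - r) + I * (m * φ)

/-- The exponent of the initial value of the modes. -/
noncomputable def modePhase (η : ℝ) (m' : ℤ) (φ ρ : ℝ) : ℂ :=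
  -(1 / 2) * Real.log ρ + I * (ρ * η + m' * φ)

/-- The exponent `ε + i ξ` of the wave packet. -/
noncomputable def packetExponent (ε ξ : ℝ) : ℂ := ε + I * ξ

@[simp] theorem packetExponent_re (ε ξ : ℝ) : (packetExponent ε ξ).re = ε := by
  simp [packetExponent]

@[simp] theorem packetExponent_im (ε ξ : ℝ) : (packetExponent ε ξ).im = ξ := by
  simp [packetExponent]

/-- Once all factors sit in a single exponent, a radial derivative is multiplication by the
derivative of that exponent. -/
theorem packetData_eq {M Q ε η₀ : ℝ} {m : ℤ} {a ρ φ : ℝ} (hM : 0 < M) (hρ : rPlus M Q < ρ) :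
    packetData M Q ε η₀ m a ρ φ
      = cexp (packetPhase (rPlus M Q) a (packetExponent ε (xiHat M Q η₀)) m φ ρ) := by
  have h₀ : 0 < ρ := (rPlus_pos hM).trans hρ
  have h₁ : 0 < ρ - rPlus M Q := sub_pos.2 hρ
  rw [packetData, if_pos hρ, mul_assoc, ofReal_mul, one_div_sqrt_eq_exp h₀,
    Real.rpow_def_of_pos h₁, ← Real.exp_add, abs_of_pos h₁, ofReal_exp, ← Complex.exp_add,
    ← Complex.exp_add, packetPhase, packetExponent]
  congr 1
  push_cast
  ring

/-- The normalization of the modes without the factor `ρ^{-1/2}`. -/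
noncomputable def modeNorm (a η : ℝ) : ℝ :=
  1 / (√2 * (2 * Real.pi) * (η ^ 2 + a ^ 2) ^ (1 / 4 : ℝ))

theorem modeData_eq {a η : ℝ} {m' : ℤ} {ρ φ : ℝ} (hρ : 0 < ρ) :
    modeData a η m' ρ φ = modeNorm a η * cexp (modePhase η m' φ ρ) := by
  rw [modeData, modePhase, Complex.exp_add, ← one_div_sqrt_eq_exp hρ, ← mul_assoc]
  congr 1
  rw [← ofReal_mul, gammaMode, modeNorm]
  congr 1
  field_simp

theorem hasDerivAt_packetPhase {r a : ℝ} {z : ℂ} {m : ℤ} {φ ρ : ℝ} (h₀ : 0 < ρ) (h : r < ρ) :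
    HasDerivAt (packetPhase r a z m φ) (-1 / (2 * ρ) + z / (ρ - r : ℝ) - a) ρ := by
  have h₁ : 0 < ρ - r := sub_pos.2 h
  have e₁ : HasDerivAt (fun x : ℝ => (Real.log x : ℂ)) ((ρ⁻¹ : ℝ) : ℂ) ρ :=
    (Real.hasDerivAt_log h₀.ne').ofReal_comp
  have e₂ : HasDerivAt (fun x : ℝ => (Real.log (x - r) : ℂ)) ((1 / (ρ - r) : ℝ) : ℂ) ρ :=
    (((hasDerivAt_id ρ).sub_const r).log h₁.ne').ofReal_comp
  have e₃ : HasDerivAt (fun x : ℝ => ((x : ℂ) - r)) 1 ρ :=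
    (hasDerivAt_id ρ).ofReal_comp.sub_const _
  have := (((e₁.const_mul (-(1 / 2) : ℂ)).add (e₂.const_mul z)).sub
    (e₃.const_mul (a : ℂ))).add_const (I * (m * φ))
  refine this.congr_deriv ?_
  push_cast
  have : (ρ : ℂ) ≠ 0 := by exact_mod_cast h₀.ne'
  have : (ρ : ℂ) - r ≠ 0 := by exact_mod_cast h₁.ne'
  field_simp

theorem hasDerivAt_modePhase {η : ℝ} {m' : ℤ} {φ ρ : ℝ} (h₀ : 0 < ρ) :
    HasDerivAt (modePhase η m' φ) (-1 / (2 * ρ) + I * η) ρ := by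
  have e₁ : HasDerivAt (fun x : ℝ => (Real.log x : ℂ)) ((ρ⁻¹ : ℝ) : ℂ) ρ :=
    (Real.hasDerivAt_log h₀.ne').ofReal_comp
  have e₃ : HasDerivAt (fun x : ℝ => (x : ℂ)) 1 ρ := (hasDerivAt_id ρ).ofReal_comp
  have := (e₁.const_mul (-(1 / 2) : ℂ)).add
    (((e₃.mul_const (η : ℂ)).add_const (m' * φ : ℂ)).const_mul I)
  refine this.congr_deriv ?_
  push_cast
  have : (ρ : ℂ) ≠ 0 := by exact_mod_cast h₀.ne'
  field_simp

theorem dRad_eq {u : SpacetimeFun} {t ρ φ : ℝ} {g : ℝ → ℂ} {g' : ℂ} {s : Set ℝ}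
    (hs : s ∈ 𝓝 ρ) (hu : ∀ x ∈ s, u t x φ = g x) (hg : HasDerivAt g g' ρ) :
    dRad u t ρ φ = g' :=
  (hg.congr_of_eventuallyEq (by filter_upwards [hs] with x hx using hu x hx)).deriv

theorem IsWavePacket.eq_exp {M Q ε η₀ : ℝ} {m : ℤ} {a : ℝ} {C : SpacetimeFun} (hM : 0 < M)
    (hC : IsWavePacket M Q ε η₀ m a C) {ρ : ℝ} (hρ : rPlus M Q < ρ) (φ : ℝ) :
    C 0 ρ φ = cexp (packetPhase (rPlus M Q) a (packetExponent ε (xiHat M Q η₀)) m φ ρ) := by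
  rw [hC.value ρ φ ((rPlus_pos hM).trans hρ), packetData_eq hM hρ]

theorem IsWavePacket.dTime_eq {M Q ε η₀ : ℝ} {m : ℤ} {a : ℝ} {C : SpacetimeFun} (hM : 0 < M)
    (hC : IsWavePacket M Q ε η₀ m a C) {ρ : ℝ} (hρ : rPlus M Q < ρ) (φ : ℝ) :
    dTime C 0 ρ φ = I * betaHat M Q η₀ ρ * C 0 ρ φ := by
  rw [dTime, (hC.velocity ρ φ ((rPlus_pos hM).trans hρ)).deriv,
    hC.value ρ φ ((rPlus_pos hM).trans hρ)]

theorem IsWavePacket.dRad_eq {M Q ε η₀ : ℝ} {m : ℤ} {a : ℝ} {C : SpacetimeFun} (hM : 0 < M)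
    (hC : IsWavePacket M Q ε η₀ m a C) {ρ : ℝ} (hρ : rPlus M Q < ρ) (φ : ℝ) :
    dRad C 0 ρ φ = (-1 / (2 * ρ) + packetExponent ε (xiHat M Q η₀) / (ρ - rPlus M Q : ℝ) - a)
      * C 0 ρ φ := by
  rw [RN.dRad_eq (Ioi_mem_nhds hρ) (fun x hx => hC.eq_exp hM hx φ)
    (hasDerivAt_packetPhase ((rPlus_pos hM).trans hρ) hρ).cexp, hC.eq_exp hM hρ, mul_comm]

theorem IsWavePacket.eq_zero {M Q ε η₀ : ℝ} {m : ℤ} {a : ℝ} {C : SpacetimeFun}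
    (hC : IsWavePacket M Q ε η₀ m a C) {ρ : ℝ} (h₀ : 0 < ρ) (hρ : ρ < rPlus M Q) (φ : ℝ) :
    C 0 ρ φ = 0 := by
  rw [hC.value ρ φ h₀, packetData, if_neg hρ.not_gt]

theorem IsWavePacket.dTime_eq_zero {M Q ε η₀ : ℝ} {m : ℤ} {a : ℝ} {C : SpacetimeFun}
    (hC : IsWavePacket M Q ε η₀ m a C) {ρ : ℝ} (h₀ : 0 < ρ) (hρ : ρ < rPlus M Q) (φ : ℝ) :
    dTime C 0 ρ φ = 0 := by
  rw [dTime, (hC.velocity ρ φ h₀).deriv, packetData, if_neg hρ.not_gt, mul_zero]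

theorem IsWavePacket.dRad_eq_zero {M Q ε η₀ : ℝ} {m : ℤ} {a : ℝ} {C : SpacetimeFun}
    (hC : IsWavePacket M Q ε η₀ m a C) {ρ : ℝ} (h₀ : 0 < ρ) (hρ : ρ < rPlus M Q) (φ : ℝ) :
    dRad C 0 ρ φ = 0 :=
  RN.dRad_eq (Ioo_mem_nhds h₀ hρ) (fun _ hx => hC.eq_zero hx.1 hx.2 φ) (hasDerivAt_const ρ (0 : ℂ))

/-! ### Klein-Gordon products -/

/-- The integrand of the Klein-Gordon product. -/
noncomputable def kgDensity (M Q : ℝ) (u v : SpacetimeFun) (t ρ φ : ℝ) : ℂ :=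
  ((2 - lapse M Q ρ : ℝ) * (conj (u t ρ φ) * dTime v t ρ φ - conj (dTime u t ρ φ) * v t ρ φ)
      + (lapse M Q ρ - 1 : ℝ) *
        (conj (u t ρ φ) * dRad v t ρ φ - conj (dRad u t ρ φ) * v t ρ φ)) * (ρ : ℂ)

theorem intervalIntegral_exp_int (n : ℤ) :
    ∫ φ in (0 : ℝ)..(2 * Real.pi), cexp (I * (n * φ)) = if n = 0 then 2 * Real.pi else 0 := by
  split_ifs with h
  · simp [h]
  · have hn : (I * n : ℂ) ≠ 0 := mul_ne_zero I_ne_zero (by exact_mod_cast h)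
    have := integral_exp_mul_complex (a := 0) (b := 2 * Real.pi) hn
    simp only [← mul_assoc] at this ⊢
    rw [this]
    have h₁ : cexp (I * n * (2 * Real.pi : ℝ)) = 1 := by
      rw [← Complex.exp_int_mul_two_pi_mul_I n]
      congr 1; push_cast; ring
    rw [h₁]; simp

/-- The angular integral selects `n = 0`, and the radial integral starts at the horizon; the horizon
itself, where nothing is assumed, is a null set. -/
theorem kgInner_eq {M Q : ℝ} (hM : 0 < M) {u v : SpacetimeFun} {n : ℤ} {w : ℝ → ℂ}
    (h₀ : ∀ ρ φ, 0 < ρ → ρ < rPlus M Q → kgDensity M Q u v 0 ρ φ = 0)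
    (h₁ : ∀ ρ φ, rPlus M Q < ρ →
      kgDensity M Q u v 0 ρ φ = w (ρ - rPlus M Q) * cexp (I * (n * φ))) :
    kgInner M Q 0 u v = if n = 0 then 2 * Real.pi * I * ∫ s in Ioi (0 : ℝ), w s else 0 := by
  have hφ : ∀ ρ ∈ Ioi (rPlus M Q),
      ∫ φ in (0 : ℝ)..(2 * Real.pi), kgDensity M Q u v 0 ρ φ
        = w (ρ - rPlus M Q) * if n = 0 then 2 * Real.pi else 0 := fun ρ hρ => by
    simp_rw [h₁ ρ _ hρ]
    rw [intervalIntegral.integral_const_mul, intervalIntegral_exp_int]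
  have hρ : ∫ ρ in Ioi (0 : ℝ), ∫ φ in (0 : ℝ)..(2 * Real.pi), kgDensity M Q u v 0 ρ φ
      = ∫ ρ in Ioi (rPlus M Q), ∫ φ in (0 : ℝ)..(2 * Real.pi), kgDensity M Q u v 0 ρ φ := by
    refine setIntegral_eq_of_subset_of_ae_sdiff_eq_zero measurableSet_Ioi.nullMeasurableSet
      (Ioi_subset_Ioi (rPlus_pos hM).le) ?_
    filter_upwards [Measure.ae_ne volume (rPlus M Q)] with ρ hne hρ
    have : ρ < rPlus M Q := lt_of_le_of_ne (not_lt.1 hρ.2) hne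
    simp_rw [h₀ ρ _ hρ.1 this]
    simp
  have hshift : ∫ ρ in Ioi (rPlus M Q), w (ρ - rPlus M Q) = ∫ s in Ioi (0 : ℝ), w s := by
    have := (measurePreserving_sub_right volume (rPlus M Q)).setIntegral_preimage_emb
      (measurableEmbedding_subRight _) w (Ioi 0)
    simpa using this
  change I * ∫ ρ in Ioi (0 : ℝ), ∫ φ in (0 : ℝ)..(2 * Real.pi), kgDensity M Q u v 0 ρ φ = _
  rw [hρ, setIntegral_congr_fun measurableSet_Ioi hφ, integral_mul_const, hshift]
  split_ifs
  · push_cast; ring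
  · simp

/-- Only imaginary parts of logarithmic derivatives contribute: $-f\hat\xi_0/s$ from time and
$(f-1)\hat\xi_0/s$ from $\rho$. Their sum is $-\hat\xi_0/s$, free of $f$, and a real $\Gamma$
integral remains. -/
theorem kgInner_self {M Q ε η₀ : ℝ} {m : ℤ} {a : ℝ} {C : SpacetimeFun} (hM : 0 < M)
    (hQ : Q ^ 2 < M ^ 2) (hε : 0 < ε) (ha : 0 < a) (hC : IsWavePacket M Q ε η₀ m a C) :
    kgInner M Q 0 C C
      = (4 * Real.pi * xiHat M Q η₀ * ((1 / (2 * a)) ^ (2 * ε) * Real.Gamma (2 * ε)) : ℝ) := by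
  have h : ∀ ρ φ, rPlus M Q < ρ → kgDensity M Q C C 0 ρ φ
      = -2 * I * xiHat M Q η₀ * (((ρ - rPlus M Q) ^ (2 * ε - 1)
        * Real.exp (-(2 * a * (ρ - rPlus M Q))) : ℝ) : ℂ) * cexp (I * ((0 : ℤ) * φ)) := by
    intro ρ φ hρ
    have h₀ : 0 < ρ := (rPlus_pos hM).trans hρ
    have h₁ : 0 < ρ - rPlus M Q := sub_pos.2 hρ
    have hnorm : conj (C 0 ρ φ) * C 0 ρ φ
        = (((ρ - rPlus M Q) ^ (2 * ε) * Real.exp (-(2 * a * (ρ - rPlus M Q))) / ρ : ℝ) : ℂ) := by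
      rw [hC.eq_exp hM hρ, ← Complex.exp_conj, ← Complex.exp_add,
        Real.rpow_def_of_pos h₁, ← Real.exp_add]
      -- The fifth occurrence of `ρ` is the denominator on the right; the earlier ones stand in the
      -- exponents.
      nth_rewrite 5 [← Real.exp_log h₀]
      rw [← Real.exp_sub, ofReal_exp]
      congr 1
      simp only [packetPhase, packetExponent, map_add, map_sub, map_mul, map_neg, map_div₀,
        map_one, map_ofNat, conj_ofReal, conj_I, map_intCast, ofReal_add, ofReal_sub, ofReal_mul,
        ofReal_neg, ofReal_ofNat]
      ring
    have hβ : ((2 - lapse M Q ρ : ℝ) : ℂ) * betaHat M Q η₀ ρ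
        = ((-lapse M Q ρ * (xiHat M Q η₀ / (ρ - rPlus M Q)) : ℝ) : ℂ) := by
      rw [← ofReal_mul, betaHat, mul_div_cancel₀ _ (two_sub_lapse_pos hM hQ hρ).ne']
    have e : kgDensity M Q C C 0 ρ φ = (2 * I * (((2 - lapse M Q ρ : ℝ) : ℂ) * betaHat M Q η₀ ρ)
        + (lapse M Q ρ - 1 : ℝ) * (2 * I * (xiHat M Q η₀ / (ρ - rPlus M Q) : ℝ)))
          * (conj (C 0 ρ φ) * C 0 ρ φ) * ρ := by
      rw [kgDensity, hC.dTime_eq hM hρ, hC.dRad_eq hM hρ]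
      simp only [packetExponent, map_add, map_sub, map_mul, map_neg, map_div₀,
        map_one, map_ofNat, conj_ofReal, conj_I, ofReal_sub, ofReal_div]
      ring
    have hρ' : (ρ : ℂ) ≠ 0 := by exact_mod_cast h₀.ne'
    have h₁' : ((ρ - rPlus M Q : ℝ) : ℂ) ≠ 0 := by exact_mod_cast h₁.ne'
    rw [e, hβ, hnorm, Real.rpow_sub_one h₁.ne']
    simp only [Int.cast_zero, zero_mul, mul_zero, Complex.exp_zero, mul_one]
    simp only [ofReal_mul, ofReal_div, ofReal_neg]
    push_cast at h₁' ⊢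
    field_simp
    ring
  rw [kgInner_eq hM (n := 0) (w := fun s => -2 * I * xiHat M Q η₀
    * ((s ^ (2 * ε - 1) * Real.exp (-(2 * a * s)) : ℝ) : ℂ))
    (fun ρ φ h₀ hρ => by
      simp [kgDensity, hC.eq_zero h₀ hρ, hC.dTime_eq_zero h₀ hρ, hC.dRad_eq_zero h₀ hρ]) h,
    if_pos rfl, integral_const_mul, integral_complex_ofReal,
    Real.integral_rpow_mul_exp_neg_mul_Ioi (by positivity) (by positivity)]
  generalize (1 / (2 * a)) ^ (2 * ε) * Real.Gamma (2 * ε) = G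
  push_cast
  linear_combination (-4 * Real.pi * xiHat M Q η₀ * G : ℂ) * I_sq

/-- The product of a mode with the wave packet, up to a phase and normalization; `σ` is the sign
of the square root in the frequency of the mode. -/
noncomputable def overlap (q : ℝ → ℝ) (z : ℂ) (a σ η : ℝ) : ℂ :=
  ∫ s in Ioi (0 : ℝ), (s : ℂ) ^ z * cexp (-(a + I * η) * s) *
    (σ * I * √(η ^ 2 + a ^ 2) - z / s + a + q s * (z.re - a * s))

/-- The frequencies are such that $(f-1)\eta$ cancels between the time and radial terms, and
$f\hat\xi_0/s$ cancels against the imaginary part of $fz/s$. The lapse survives only in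
$q(s)(\varepsilon-as)$. The weight $\rho$ absorbs the two factors $\rho^{-1/2}$. -/
theorem kgInner_mode {M Q ε η₀ : ℝ} {m : ℤ} {a : ℝ} {C u : SpacetimeFun} (hM : 0 < M)
    (hQ : Q ^ 2 < M ^ 2) (hC : IsWavePacket M Q ε η₀ m a C) {σ η : ℝ} {m' : ℤ}
    (hu : ∀ ρ φ, rPlus M Q < ρ → u 0 ρ φ = modeData a η m' ρ φ)
    (hu' : ∀ ρ φ, rPlus M Q < ρ → HasDerivAt (fun t => u t ρ φ)
      (I * ((-(lapse M Q ρ - 1) * η + σ * √(η ^ 2 + a ^ 2)) / (2 - lapse M Q ρ) : ℝ)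
        * modeData a η m' ρ φ) 0) :
    kgInner M Q 0 u C = if m' = m then 2 * Real.pi * I * (modeNorm a η * cexp (-I * η * rPlus M Q)
      * overlap (lapseQuot M Q) (packetExponent ε (xiHat M Q η₀)) a σ η) else 0 := by
  obtain ⟨w, hw⟩ : ∃ w : ℝ → ℂ, w = fun s : ℝ => modeNorm a η * cexp (-I * η * rPlus M Q) *
        ((s : ℂ) ^ (packetExponent ε (xiHat M Q η₀)) * cexp (-(a + I * η) * s) *
        (σ * I * √(η ^ 2 + a ^ 2) - packetExponent ε (xiHat M Q η₀) / s + a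
          + lapseQuot M Q s * ((packetExponent ε (xiHat M Q η₀)).re - a * s))) := ⟨_, rfl⟩
  have h : ∀ ρ φ, rPlus M Q < ρ → kgDensity M Q u C 0 ρ φ
      = w (ρ - rPlus M Q) * cexp (I * ((m - m' : ℤ) * φ)) := by
    intro ρ φ hρ
    have h₀ : 0 < ρ := (rPlus_pos hM).trans hρ
    have h₁ : 0 < ρ - rPlus M Q := sub_pos.2 hρ
    have hρ' : (ρ : ℂ) ≠ 0 := by exact_mod_cast h₀.ne'
    have h₁' : ((ρ - rPlus M Q : ℝ) : ℂ) ≠ 0 := by exact_mod_cast h₁.ne'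
    have hprod : conj (u 0 ρ φ) * C 0 ρ φ * ρ
        = modeNorm a η * cexp (-I * η * rPlus M Q)
          * (((ρ - rPlus M Q : ℝ) : ℂ) ^ (packetExponent ε (xiHat M Q η₀))
            * cexp (-(a + I * η) * (ρ - rPlus M Q : ℝ))) * cexp (I * ((m - m' : ℤ) * φ)) := by
      have hlog : (ρ : ℂ) = cexp (Real.log ρ) := by rw [← ofReal_exp, Real.exp_log h₀]
      rw [hu ρ φ hρ, modeData_eq h₀, hC.eq_exp hM hρ, Complex.cpow_def_of_ne_zero h₁',
        ← ofReal_log h₁.le, map_mul, conj_ofReal, ← Complex.exp_conj]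
      rw [hlog]
      simp only [mul_assoc, ← Complex.exp_add]
      congr 2
      simp only [packetPhase, modePhase, map_add, map_mul, map_neg, map_div₀,
        map_one, map_ofNat, conj_ofReal, conj_I, map_intCast, ofReal_sub, Int.cast_sub]
      ring
    have hβ : ((2 - lapse M Q ρ : ℝ) : ℂ) * betaHat M Q η₀ ρ
        = ((-lapse M Q ρ * (xiHat M Q η₀ / (ρ - rPlus M Q)) : ℝ) : ℂ) := by
      rw [← ofReal_mul, betaHat, mul_div_cancel₀ _ (two_sub_lapse_pos hM hQ hρ).ne']
    set l : ℝ := (-(lapse M Q ρ - 1) * η + σ * √(η ^ 2 + a ^ 2)) / (2 - lapse M Q ρ) with hl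
    have hlam : ((2 - lapse M Q ρ : ℝ) : ℂ) * l
        = ((-(lapse M Q ρ - 1) * η + σ * √(η ^ 2 + a ^ 2) : ℝ) : ℂ) := by
      rw [← ofReal_mul, hl, mul_div_cancel₀ _ (two_sub_lapse_pos hM hQ hρ).ne']
    have hT : dTime u 0 ρ φ = I * l * u 0 ρ φ := by
      rw [dTime, (hu' ρ φ hρ).deriv, hu ρ φ hρ]
    have hR : dRad u 0 ρ φ = (-1 / (2 * ρ) + I * η) * u 0 ρ φ := by
      rw [dRad_eq (Ioi_mem_nhds hρ) (fun x hx => (hu x φ hx).trans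
        (modeData_eq ((rPlus_pos hM).trans hx)))
        ((hasDerivAt_modePhase h₀).cexp.const_mul _), hu ρ φ hρ, modeData_eq h₀]
      ring
    have e : kgDensity M Q u C 0 ρ φ = (I * (((2 - lapse M Q ρ : ℝ) : ℂ) * betaHat M Q η₀ ρ)
        + I * (((2 - lapse M Q ρ : ℝ) : ℂ) * l)
        + (lapse M Q ρ - 1 : ℝ) * (packetExponent ε (xiHat M Q η₀) / (ρ - rPlus M Q : ℝ)
          - a + I * η)) * (conj (u 0 ρ φ) * C 0 ρ φ * ρ) := by
      rw [kgDensity, hC.dTime_eq hM hρ, hC.dRad_eq hM hρ, hT, hR]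
      simp only [map_add, map_mul, map_neg, map_div₀,
        map_one, map_ofNat, conj_ofReal, conj_I]
      ring
    rw [e, hβ, hlam, hprod, lapse_eq hM hQ hρ, hw]
    simp only [packetExponent_re]
    have hz : packetExponent ε (xiHat M Q η₀) = ε + I * xiHat M Q η₀ := rfl
    generalize lapseQuot M Q (ρ - rPlus M Q) = q
    generalize ρ - rPlus M Q = s at h₁' ⊢
    rw [show ((packetExponent ε (xiHat M Q η₀) : ℂ) / s) = (ε + I * xiHat M Q η₀) / s from rfl]
    have hbr : I * ((-(s * q) * (xiHat M Q η₀ / s) : ℝ) : ℂ)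
        + I * ((-(s * q - 1) * η + σ * √(η ^ 2 + a ^ 2) : ℝ) : ℂ)
        + (s * q - 1 : ℝ) * ((ε + I * xiHat M Q η₀) / s - a + I * η)
        = σ * I * √(η ^ 2 + a ^ 2) - (ε + I * xiHat M Q η₀) / s + a + q * (ε - a * s) := by
      push_cast
      field_simp
      ring
    rw [hbr]
    ring
  rw [kgInner_eq hM (fun ρ φ h₀ hρ => by
      simp [kgDensity, hC.eq_zero h₀ hρ, hC.dTime_eq_zero h₀ hρ, hC.dRad_eq_zero h₀ hρ]) h, hw,
    integral_const_mul, overlap]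
  simp only [sub_eq_zero, eq_comm (a := m)]

theorem kgInner_normalized_right (M Q : ℝ) (u C : SpacetimeFun) :
    kgInner M Q 0 u (normalized M Q C)
      = kgInner M Q 0 u C / (√(kgInner M Q 0 C C).re : ℝ) := by
  have h₁ : ∀ t ρ φ, dTime (normalized M Q C) t ρ φ
      = dTime C t ρ φ / (√(kgInner M Q 0 C C).re : ℝ) := fun t ρ φ => deriv_div_const _
  have h₂ : ∀ t ρ φ, dRad (normalized M Q C) t ρ φ
      = dRad C t ρ φ / (√(kgInner M Q 0 C C).re : ℝ) := fun t ρ φ => deriv_div_const _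
  rw [kgInner, kgInner, mul_div_assoc, ← integral_div]
  simp_rw [← intervalIntegral.integral_div, h₁, h₂, normalized]
  congr 4 with ρ
  congr 1 with φ
  ring

theorem kgInner_normalized_left (M Q : ℝ) (C v : SpacetimeFun) :
    kgInner M Q 0 (normalized M Q C) v
      = kgInner M Q 0 C v / (√(kgInner M Q 0 C C).re : ℝ) := by
  have h₁ : ∀ t ρ φ, dTime (normalized M Q C) t ρ φ
      = dTime C t ρ φ / (√(kgInner M Q 0 C C).re : ℝ) := fun t ρ φ => deriv_div_const _
  have h₂ : ∀ t ρ φ, dRad (normalized M Q C) t ρ φ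
      = dRad C t ρ φ / (√(kgInner M Q 0 C C).re : ℝ) := fun t ρ φ => deriv_div_const _
  rw [kgInner, kgInner, mul_div_assoc, ← integral_div]
  simp_rw [← intervalIntegral.integral_div, h₁, h₂, normalized, map_div₀, conj_ofReal]
  congr 4 with ρ
  congr 1 with φ
  ring

theorem kgInner_normalized {M Q : ℝ} {C : SpacetimeFun} {N : ℝ} (hN : 0 < N)
    (h : kgInner M Q 0 C C = N) :
    kgInner M Q 0 (normalized M Q C) (normalized M Q C) = 1 := by
  have h₀ : ((√N : ℝ) : ℂ) ≠ 0 := by exact_mod_cast (Real.sqrt_pos.2 hN).ne'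
  rw [kgInner_normalized_right, kgInner_normalized_left, h, ofReal_re, div_div, ← ofReal_mul,
    Real.mul_self_sqrt hN.le, div_self (by exact_mod_cast hN.ne')]

end RN

/-! ### Laplace transforms on vertical lines -/

namespace RN

/-- The complex rate `a + i η`. -/
noncomputable def rate (a η : ℝ) : ℂ := a + I * η

@[simp] theorem rate_re (a η : ℝ) : (rate a η).re = a := by simp [rate]

@[simp] theorem rate_im (a η : ℝ) : (rate a η).im = η := by simp [rate]

theorem rate_mem_slitPlane {a : ℝ} (ha : 0 < a) (η : ℝ) : rate a η ∈ slitPlane :=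
  Or.inl (by simpa using ha)

theorem rate_ne_zero {a : ℝ} (ha : 0 < a) (η : ℝ) : rate a η ≠ 0 :=
  slitPlane_ne_zero (rate_mem_slitPlane ha η)

theorem norm_rate (a η : ℝ) : ‖rate a η‖ = √(η ^ 2 + a ^ 2) := by
  rw [Complex.norm_eq_sqrt_sq_add_sq, rate_re, rate_im, add_comm]

theorem norm_exp_rate (a η s : ℝ) : ‖cexp (-rate a η * s)‖ = Real.exp (-a * s) := by
  rw [Complex.norm_exp]
  simp

theorem integrableOn_rpow_mul_exp {p a : ℝ} (hp : -1 < p) (ha : 0 < a) :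
    IntegrableOn (fun s : ℝ => s ^ p * Real.exp (-a * s)) (Ioi 0) := by
  simpa using integrableOn_rpow_mul_exp_neg_mul_rpow hp one_pos ha

theorem rpow_mul_one_add_sq {s : ℝ} (hs : 0 < s) (p : ℝ) :
    s ^ p * (1 + s) ^ 2 = s ^ p + 2 * s ^ (p + 1) + s ^ (p + 2) := by
  rw [Real.rpow_add hs, Real.rpow_add hs, Real.rpow_one, Real.rpow_two]
  ring

/-- A common majorant for all powers between `p` and `p + 2`, which is the range met in the
amplitudes below and in their derivatives. -/
theorem integrableOn_rpow_mul_one_add_sq {p a : ℝ} (hp : -1 < p) (ha : 0 < a) :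
    IntegrableOn (fun s : ℝ => s ^ p * (1 + s) ^ 2 * Real.exp (-a * s)) (Ioi 0) := by
  have := ((integrableOn_rpow_mul_exp hp ha).add
    ((integrableOn_rpow_mul_exp (p := p + 1) (by linarith) ha).const_mul 2)).add
    (integrableOn_rpow_mul_exp (p := p + 2) (by linarith) ha)
  refine this.congr_fun (fun s hs => ?_) measurableSet_Ioi
  simp only [Pi.add_apply]
  rw [rpow_mul_one_add_sq hs]
  ring

theorem norm_mul_exp_rate_le {H : ℝ → ℂ} {B p a η s : ℝ}
    (hb : ‖H s‖ ≤ B * (s ^ p * (1 + s) ^ 2)) :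
    ‖H s * cexp (-rate a η * s)‖ ≤ B * (s ^ p * (1 + s) ^ 2 * Real.exp (-a * s)) := by
  rw [norm_mul, norm_exp_rate, ← mul_assoc]
  exact mul_le_mul_of_nonneg_right hb (Real.exp_pos _).le

theorem continuous_exp_rate (a η : ℝ) : Continuous fun s : ℝ => cexp (-rate a η * s) := by
  fun_prop

theorem integrableOn_mul_exp_rate {H : ℝ → ℂ} {B p a : ℝ} (hp : -1 < p) (ha : 0 < a) (η : ℝ)
    (hc : ContinuousOn H (Ioi 0)) (hb : ∀ s, 0 < s → ‖H s‖ ≤ B * (s ^ p * (1 + s) ^ 2)) :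
    IntegrableOn (fun s : ℝ => H s * cexp (-rate a η * s)) (Ioi 0) := by
  refine Integrable.mono' ((integrableOn_rpow_mul_one_add_sq hp ha).const_mul B)
    ((hc.mul (continuous_exp_rate a η).continuousOn).aestronglyMeasurable measurableSet_Ioi) ?_
  filter_upwards [ae_restrict_mem measurableSet_Ioi] with s hs
  exact norm_mul_exp_rate_le (hb s hs)

theorem tendsto_rpow_mul_one_add_sq_zero {p a : ℝ} (hp : 0 < p) :
    Tendsto (fun s : ℝ => s ^ p * (1 + s) ^ 2 * Real.exp (-a * s)) (𝓝[>] 0) (𝓝 0) := by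
  have h : ContinuousAt (fun s : ℝ => s ^ p * (1 + s) ^ 2 * Real.exp (-a * s)) 0 :=
    ((Real.continuousAt_rpow_const 0 p (Or.inr hp.le)).mul (by fun_prop)).mul (by fun_prop)
  have h' := h.tendsto.mono_left (nhdsWithin_le_nhds (s := Ioi 0))
  simpa [Real.zero_rpow hp.ne'] using h'

theorem tendsto_rpow_mul_one_add_sq_atTop {p a : ℝ} (ha : 0 < a) :
    Tendsto (fun s : ℝ => s ^ p * (1 + s) ^ 2 * Real.exp (-a * s)) atTop (𝓝 0) := by
  have := ((tendsto_rpow_mul_exp_neg_mul_atTop_nhds_zero p a ha).add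
    ((tendsto_rpow_mul_exp_neg_mul_atTop_nhds_zero (p + 1) a ha).const_mul 2)).add
    (tendsto_rpow_mul_exp_neg_mul_atTop_nhds_zero (p + 2) a ha)
  simp only [mul_zero, add_zero] at this
  refine this.congr' ?_
  filter_upwards [eventually_gt_atTop 0] with s hs
  rw [rpow_mul_one_add_sq hs]
  ring

/-- Integration by parts for Laplace transforms. -/
theorem rate_mul_integral {H H' : ℝ → ℂ} {B p a : ℝ} (hp : 0 < p) (ha : 0 < a) (η : ℝ)
    (hd : ∀ s, 0 < s → HasDerivAt H (H' s) s) (hc : ContinuousOn H' (Ioi 0))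
    (hb : ∀ s, 0 < s → ‖H s‖ ≤ B * (s ^ p * (1 + s) ^ 2))
    (hb' : ∀ s, 0 < s → ‖H' s‖ ≤ B * (s ^ (p - 1) * (1 + s) ^ 2)) :
    rate a η * ∫ s in Ioi (0 : ℝ), H s * cexp (-rate a η * s)
      = ∫ s in Ioi (0 : ℝ), H' s * cexp (-rate a η * s) := by
  have hcH : ContinuousOn H (Ioi 0) := fun s hs => (hd s hs).continuousAt.continuousWithinAt
  have hv : ∀ s ∈ Ioi (0 : ℝ), HasDerivAt (fun s : ℝ => cexp (-rate a η * s))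
      (-rate a η * cexp (-rate a η * s)) s := fun s _ => by
    have := (((hasDerivAt_id s).ofReal_comp).const_mul (-rate a η)).cexp
    simpa [mul_comm] using this
  have hlim : ∀ l : Filter ℝ, (∀ᶠ s in l, 0 < s) →
      Tendsto (fun s : ℝ => s ^ p * (1 + s) ^ 2 * Real.exp (-a * s)) l (𝓝 0) →
      Tendsto (H * fun s : ℝ => cexp (-rate a η * s)) l (𝓝 0) := fun l hl h => by
    refine squeeze_zero_norm' ?_ (mul_zero B ▸ h.const_mul B)
    filter_upwards [hl] with s hs
    exact norm_mul_exp_rate_le (hb s hs)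
  have h₁ := integrableOn_mul_exp_rate (by linarith) ha η hcH hb
  have h₂ := integrableOn_mul_exp_rate (by linarith) ha η hc hb'
  have := integral_Ioi_mul_deriv_eq_deriv_mul hd hv
    (IntegrableOn.congr_fun (h₁.const_mul (-rate a η)) (fun s _ => by simp only [Pi.mul_apply]; ring)
      measurableSet_Ioi) h₂
    (hlim _ self_mem_nhdsWithin (tendsto_rpow_mul_one_add_sq_zero hp))
    (hlim _ (eventually_gt_atTop 0) (tendsto_rpow_mul_one_add_sq_atTop ha))
  rw [sub_zero, zero_sub] at this
  rw [← neg_inj, ← this, ← neg_mul, ← integral_const_mul]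
  exact integral_congr_ae (Eventually.of_forall fun s => by ring)

theorem norm_ofReal_cpow {s : ℝ} (hs : 0 < s) (z : ℂ) : ‖(s : ℂ) ^ z‖ = s ^ z.re :=
  Complex.norm_cpow_eq_rpow_re_of_pos hs z

theorem continuousOn_ofReal_cpow (z : ℂ) : ContinuousOn (fun s : ℝ => (s : ℂ) ^ z) (Ioi 0) :=
  fun s hs => (Complex.continuousAt_ofReal_cpow_const s z
    (Or.inr (ne_of_gt hs))).continuousWithinAt

theorem le_mul_one_add_sq {s t : ℝ} (hs : 0 < s) (ht : 0 ≤ t) : t ≤ t * (1 + s) ^ 2 := by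
  nlinarith [mul_nonneg ht hs.le, mul_nonneg ht (sq_nonneg s)]

theorem norm_ofReal_cpow_le {s : ℝ} (hs : 0 < s) (z : ℂ) :
    ‖(s : ℂ) ^ z‖ ≤ 1 * (s ^ z.re * (1 + s) ^ 2) := by
  rw [norm_ofReal_cpow hs, one_mul]
  exact le_mul_one_add_sq hs (Real.rpow_nonneg hs.le _)

theorem rate_mul_integral_cpow {z : ℂ} (hz : 0 < z.re) {a : ℝ} (ha : 0 < a) (η : ℝ) :
    rate a η * ∫ s in Ioi (0 : ℝ), (s : ℂ) ^ z * cexp (-rate a η * s)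
      = z * ∫ s in Ioi (0 : ℝ), (s : ℂ) ^ (z - 1) * cexp (-rate a η * s) := by
  have hz₀ : z ≠ 0 := fun h => by simp [h] at hz
  rw [rate_mul_integral (H' := fun s => z * (s : ℂ) ^ (z - 1)) (B := max 1 ‖z‖) hz ha η
    (fun s hs => hasDerivAt_ofReal_cpow_const hs.ne' hz₀)
    (continuousOn_const.mul (continuousOn_ofReal_cpow _)), ← integral_const_mul]
  · simp only [mul_assoc]
  · intro s hs
    exact (norm_ofReal_cpow_le hs z).trans
      (mul_le_mul_of_nonneg_right (le_max_left _ _) (by positivity))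
  · intro s hs
    have := norm_ofReal_cpow_le hs (z - 1)
    rw [sub_re, one_re, one_mul] at this
    rw [norm_mul]
    exact mul_le_mul (le_max_right _ _) this (norm_nonneg _) (by positivity)

theorem hasDerivAt_integral_cpow {z : ℂ} (hz : 0 < z.re) {a : ℝ} (ha : 0 < a) (η : ℝ) :
    HasDerivAt (fun η : ℝ => ∫ s in Ioi (0 : ℝ), (s : ℂ) ^ (z - 1) * cexp (-rate a η * s))
      (-I * ∫ s in Ioi (0 : ℝ), (s : ℂ) ^ z * cexp (-rate a η * s)) η := by
  have h₁ : ∀ η, IntegrableOn (fun s : ℝ => (s : ℂ) ^ (z - 1) * cexp (-rate a η * s)) (Ioi 0) :=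
    fun η => integrableOn_mul_exp_rate (by simpa using hz) ha η (continuousOn_ofReal_cpow _)
      (fun s hs => norm_ofReal_cpow_le hs _)
  have h₂ : ∀ η, IntegrableOn (fun s : ℝ => (s : ℂ) ^ z * cexp (-rate a η * s)) (Ioi 0) :=
    fun η => integrableOn_mul_exp_rate (by linarith) ha η (continuousOn_ofReal_cpow _)
      (fun s hs => norm_ofReal_cpow_le hs _)
  rw [← integral_const_mul]
  refine (hasDerivAt_integral_of_dominated_loc_of_deriv_le (s := univ) univ_mem
    (F := fun (η s : ℝ) => (s : ℂ) ^ (z - 1) * cexp (-rate a η * s))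
    (F' := fun (η s : ℝ) => -I * ((s : ℂ) ^ z * cexp (-rate a η * s)))
    (bound := fun s => s ^ z.re * Real.exp (-a * s))
    (Eventually.of_forall fun η => (h₁ η).aestronglyMeasurable) (h₁ η)
    ((h₂ η).const_mul (-I)).aestronglyMeasurable ?_
    (integrableOn_rpow_mul_exp (by linarith) ha) ?_).2
  · filter_upwards [ae_restrict_mem measurableSet_Ioi] with s hs η _
    rw [norm_mul, norm_mul, norm_exp_rate, norm_ofReal_cpow hs]
    simp
  · filter_upwards [ae_restrict_mem measurableSet_Ioi] with s hs η _
    have hs₀ : (s : ℂ) ≠ 0 := by exact_mod_cast (ne_of_gt hs)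
    have e : HasDerivAt (fun η : ℝ => -rate a η * s) (-(I * s)) η := by
      have := ((((hasDerivAt_id η).ofReal_comp.const_mul I).const_add (a : ℂ)).neg).mul_const
        (s : ℂ)
      simpa [rate] using this
    refine (e.cexp.const_mul ((s : ℂ) ^ (z - 1))).congr_deriv ?_
    rw [Complex.cpow_sub _ _ hs₀, Complex.cpow_one]
    field_simp

/-- The `Γ` integral with a complex rate. -/
theorem integral_cpow_mul_exp_rate {z : ℂ} (hz : 0 < z.re) {a : ℝ} (ha : 0 < a) (η : ℝ) :
    ∫ s in Ioi (0 : ℝ), (s : ℂ) ^ (z - 1) * cexp (-rate a η * s)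
      = Complex.Gamma z * rate a η ^ (-z) := by
  -- Integration by parts makes the derivative in `η` of this product vanish. The product is
  -- therefore its value at `η = 0`, where the rate is real and the integral is classical.
  have hd : ∀ η : ℝ, HasDerivAt (fun η : ℝ => rate a η ^ z *
      ∫ s in Ioi (0 : ℝ), (s : ℂ) ^ (z - 1) * cexp (-rate a η * s)) 0 η := fun η => by
    have e : HasDerivAt (fun η : ℝ => rate a η) I η := by
      have := ((hasDerivAt_id η).ofReal_comp.const_mul I).const_add (a : ℂ)
      simpa [rate] using this
    have e' : HasDerivAt (fun η : ℝ => rate a η ^ z) (z * rate a η ^ (z - 1) * I) η :=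
      (hasStrictDerivAt_cpow_const (rate_mem_slitPlane ha η)).hasDerivAt.comp_of_eq η e rfl
    refine (e'.mul (hasDerivAt_integral_cpow hz ha η)).congr_deriv ?_
    have h := rate_mul_integral_cpow hz ha η
    rw [Complex.cpow_sub _ _ (rate_ne_zero ha η), Complex.cpow_one]
    have h₀ := rate_ne_zero ha η
    generalize ∫ s in Ioi (0 : ℝ), (s : ℂ) ^ z * cexp (-rate a η * s) = X at h ⊢
    generalize ∫ s in Ioi (0 : ℝ), (s : ℂ) ^ (z - 1) * cexp (-rate a η * s) = Y at h ⊢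
    field_simp
    linear_combination (-(rate a η ^ z * I)) * h
  have hconst := is_const_of_deriv_eq_zero (fun η => (hd η).differentiableAt)
    (fun η => (hd η).deriv) η 0
  have h₀ : rate a 0 = a := by simp [rate]
  have ha₀ : (a : ℂ) ≠ 0 := by exact_mod_cast ha.ne'
  have hG := Complex.integral_cpow_mul_exp_neg_mul_Ioi hz ha
  simp only [h₀] at hconst
  simp only [← neg_mul] at hG
  rw [hG, one_div, Complex.inv_cpow _ _ (by
    rw [Complex.arg_ofReal_of_nonneg ha.le]; exact Real.pi_pos.ne), mul_inv_cancel_left₀ (by simp [Complex.cpow_eq_zero_iff, ha₀])] at hconst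
  rw [← hconst, Complex.cpow_neg, mul_comm, inv_mul_cancel_left₀]
  simp [Complex.cpow_eq_zero_iff, rate_ne_zero ha η]

end RN

/-! ### Asymptotics of the overlaps -/

namespace RN

/-- The leading part of `overlap`. -/
noncomputable def overlapMain (z : ℂ) (a η : ℝ) : ℂ :=
  Complex.Gamma (z + 1) * rate a η ^ (-(z + 1))

/-- The remainder of `overlap`, caused by the variation of the lapse. -/
noncomputable def overlapRem (q : ℝ → ℝ) (z : ℂ) (a η : ℝ) : ℂ :=
  ∫ s in Ioi (0 : ℝ), (s : ℂ) ^ z * (q s * (z.re - a * s) : ℝ) * cexp (-rate a η * s)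

/-- A function on `(0, ∞)` that is bounded together with its derivative. -/
structure IsTame (q q' : ℝ → ℝ) (B : ℝ) : Prop where
  measurable : Measurable q
  hasDerivAt : ∀ s, 0 < s → HasDerivAt q (q' s) s
  continuousOn : ContinuousOn q' (Ioi 0)
  bound : ∀ s, 0 < s → |q s| ≤ B
  bound_deriv : ∀ s, 0 < s → |q' s| ≤ B

variable {q q' : ℝ → ℝ} {B : ℝ} {z : ℂ} {a : ℝ}

theorem IsTame.nonneg (hq : IsTame q q' B) : 0 ≤ B :=
  (abs_nonneg _).trans (hq.bound 1 one_pos)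

theorem IsTame.norm_amplitude_le (hq : IsTame q q' B) (hz : 0 < z.re) (ha : 0 < a) {s : ℝ}
    (hs : 0 < s) : |q s * (z.re - a * s)| ≤ B * (z.re + a * s) := by
  rw [abs_mul]
  refine mul_le_mul (hq.bound s hs) ?_ (abs_nonneg _) hq.nonneg
  rw [abs_le]
  constructor <;> nlinarith [mul_pos ha hs]

theorem IsTame.norm_integrand_le (hq : IsTame q q' B) (hz : 0 < z.re) (ha : 0 < a) {s : ℝ}
    (hs : 0 < s) : ‖(s : ℂ) ^ z * (q s * (z.re - a * s) : ℝ)‖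
      ≤ (B * (z.re + a)) * (s ^ z.re * (1 + s) ^ 2) := by
  have h₁ := hq.norm_amplitude_le hz ha hs
  have h₀ : z.re + a * s ≤ (z.re + a) * (1 + s) ^ 2 := by
    nlinarith [mul_pos ha hs, mul_pos hz hs, mul_nonneg hz.le (sq_nonneg s),
      mul_nonneg ha.le (sq_nonneg s)]
  have h₂ := mul_le_mul_of_nonneg_left h₀ hq.nonneg
  rw [norm_mul, norm_ofReal_cpow hs, Complex.norm_real, Real.norm_eq_abs]
  calc _ ≤ s ^ z.re * (B * ((z.re + a) * (1 + s) ^ 2)) :=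
        mul_le_mul_of_nonneg_left (h₁.trans h₂) (Real.rpow_nonneg hs.le _)
    _ = _ := by ring

theorem IsTame.continuousOn_amplitude (hq : IsTame q q' B) (z : ℂ) (a : ℝ) :
    ContinuousOn (fun s : ℝ => (s : ℂ) ^ z * (q s * (z.re - a * s) : ℝ)) (Ioi 0) := by
  have hqc : ContinuousOn q (Ioi 0) :=
    fun s hs => (hq.hasDerivAt s hs).continuousAt.continuousWithinAt
  exact (continuousOn_ofReal_cpow z).mul (Complex.continuous_ofReal.comp_continuousOn
    (hqc.mul (by fun_prop)))

/-- Integration by parts replaces the term $-z/s$ by $-(a+i\eta)$, which cancels the summand $a$ and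
leaves $i(\sigma\sqrt{\eta^2+a^2}-\eta)$. -/
theorem overlap_eq (hq : IsTame q q' B) (hz : 0 < z.re) (ha : 0 < a) (σ η : ℝ) :
    overlap q z a σ η = overlapMain z a η * (I * (σ * √(η ^ 2 + a ^ 2) - η))
      + overlapRem q z a η := by
  have i₁ : IntegrableOn (fun s : ℝ => (s : ℂ) ^ z * cexp (-rate a η * s)) (Ioi 0) :=
    integrableOn_mul_exp_rate (by linarith) ha η (continuousOn_ofReal_cpow _)
      (fun s hs => norm_ofReal_cpow_le hs _)
  have i₂ : IntegrableOn (fun s : ℝ => (s : ℂ) ^ (z - 1) * cexp (-rate a η * s)) (Ioi 0) :=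
    integrableOn_mul_exp_rate (by simpa using hz) ha η (continuousOn_ofReal_cpow _)
      (fun s hs => norm_ofReal_cpow_le hs _)
  have i₁₂ : IntegrableOn (fun s : ℝ =>
      (σ * I * √(η ^ 2 + a ^ 2) + a) * ((s : ℂ) ^ z * cexp (-rate a η * s))
        - z * ((s : ℂ) ^ (z - 1) * cexp (-rate a η * s))) (Ioi 0) :=
    Integrable.sub (i₁.const_mul _) (i₂.const_mul _)
  have i₃ := integrableOn_mul_exp_rate (by linarith) ha η (hq.continuousOn_amplitude z a)
    (fun s hs => hq.norm_integrand_le hz ha hs)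
  have e₁ := integral_cpow_mul_exp_rate (z := z + 1)
    (by rw [add_re, one_re]; linarith) ha η
  have e₂ := rate_mul_integral_cpow hz ha η
  rw [add_sub_cancel_right] at e₁
  have e₃ : overlap q z a σ η = ∫ s in Ioi (0 : ℝ),
      ((σ * I * √(η ^ 2 + a ^ 2) + a) * ((s : ℂ) ^ z * cexp (-rate a η * s))
        - z * ((s : ℂ) ^ (z - 1) * cexp (-rate a η * s)))
        + (s : ℂ) ^ z * (q s * (z.re - a * s) : ℝ) * cexp (-rate a η * s) := by
    refine setIntegral_congr_fun measurableSet_Ioi fun s hs => ?_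
    have hs₀ : (s : ℂ) ≠ 0 := by exact_mod_cast (ne_of_gt hs)
    simp only [rate]
    rw [Complex.cpow_sub _ _ hs₀, Complex.cpow_one]
    push_cast
    field_simp
    ring
  rw [e₃, integral_add i₁₂ i₃,
    integral_sub (i₁.const_mul _) (i₂.const_mul _), integral_const_mul, integral_const_mul, ← e₂,
    e₁, overlapMain, overlapRem]
  simp only [rate]
  ring

/-- The factor $|a+i\eta|$ is traded for one derivative of the amplitude, whose Laplace transform is
bounded uniformly in $\eta$ by real $\Gamma$ integrals. -/
theorem IsTame.overlapRem_le (hq : IsTame q q' B) (hz : 0 < z.re) (ha : 0 < a) (η : ℝ) :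
    √(η ^ 2 + a ^ 2) * ‖overlapRem q z a η‖
      ≤ B * (‖z‖ * z.re * ((1 / a) ^ z.re * Real.Gamma z.re)
        + (‖z‖ * a + z.re + a) * ((1 / a) ^ (z.re + 1) * Real.Gamma (z.re + 1))
        + a * ((1 / a) ^ (z.re + 2) * Real.Gamma (z.re + 2))) := by
  have hz₀ : z ≠ 0 := fun h => by simp [h] at hz
  have hB := hq.nonneg
  have hqc : ContinuousOn q (Ioi 0) :=
    fun s hs => (hq.hasDerivAt s hs).continuousAt.continuousWithinAt
  set H' : ℝ → ℂ := fun s => z * (s : ℂ) ^ (z - 1) * (q s * (z.re - a * s) : ℝ)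
    + (s : ℂ) ^ z * (q' s * (z.re - a * s) + q s * (-a) : ℝ) with hH'
  have hle : ∀ s, 0 < s → ‖H' s‖ ≤ B * (‖z‖ * z.re * s ^ (z.re - 1)
      + (‖z‖ * a + z.re + a) * s ^ (z.re + 1 - 1) + a * s ^ (z.re + 2 - 1)) := by
    intro s hs
    have h₁ := hq.norm_amplitude_le hz ha hs
    have h₂ : |q' s * (z.re - a * s) + q s * (-a)| ≤ B * (z.re + a * s + a) := by
      refine (abs_add_le _ _).trans ?_
      have h₃ : |q' s * (z.re - a * s)| ≤ B * (z.re + a * s) := by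
        rw [abs_mul]
        refine mul_le_mul (hq.bound_deriv s hs) ?_ (abs_nonneg _) hB
        rw [abs_le]
        constructor <;> nlinarith [mul_pos ha hs]
      have h₄ : |q s * (-a)| ≤ B * a := by
        rw [abs_mul, abs_neg, abs_of_pos ha]
        exact mul_le_mul_of_nonneg_right (hq.bound s hs) ha.le
      linarith
    have e₁ : s ^ (z.re + 1 - 1) = s ^ (z.re - 1) * s := by
      rw [← Real.rpow_add_one hs.ne']; congr 1; ring
    have e₂ : s ^ (z.re + 2 - 1) = s ^ (z.re - 1) * s * s := by
      rw [← Real.rpow_add_one hs.ne', ← Real.rpow_add_one hs.ne']; congr 1; ring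
    have e₃ : s ^ z.re = s ^ (z.re - 1) * s := by
      rw [← Real.rpow_add_one hs.ne']; congr 1; ring
    have hp : 0 ≤ s ^ (z.re - 1) := Real.rpow_nonneg hs.le _
    refine (norm_add_le _ _).trans ?_
    rw [norm_mul, norm_mul, norm_mul, norm_ofReal_cpow hs, norm_ofReal_cpow hs, Complex.norm_real,
      Complex.norm_real, Real.norm_eq_abs, Real.norm_eq_abs, sub_re, one_re, e₁, e₂, e₃]
    have k₁ := mul_le_mul_of_nonneg_left h₁ (mul_nonneg (norm_nonneg z) hp)
    have k₂ := mul_le_mul_of_nonneg_left h₂ (mul_nonneg hp hs.le)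
    linarith
  have hcH' : ContinuousOn H' (Ioi 0) :=
    ((continuousOn_const.mul (continuousOn_ofReal_cpow _)).mul
      (Complex.continuous_ofReal.comp_continuousOn (hqc.mul (by fun_prop)))).add
    ((continuousOn_ofReal_cpow _).mul (Complex.continuous_ofReal.comp_continuousOn
      ((hq.continuousOn.mul (by fun_prop)).add (hqc.mul (by fun_prop)))))
  have hd : ∀ s, 0 < s → HasDerivAt (fun s : ℝ => (s : ℂ) ^ z * (q s * (z.re - a * s) : ℝ))
      (H' s) s := fun s hs => by
    have e₁ := hasDerivAt_ofReal_cpow_const hs.ne' hz₀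
    have e₂ : HasDerivAt (fun s : ℝ => z.re - a * s) (-a) s := by
      simpa using ((hasDerivAt_id s).const_mul a).const_sub z.re
    exact e₁.mul ((hq.hasDerivAt s hs).mul e₂).ofReal_comp
  have hB₂ : 0 ≤ ‖z‖ * a + z.re + a := by positivity
  -- A crude constant that dominates both the amplitude and its derivative. It only licenses the
  -- integration by parts; the estimate itself comes from `hle`.
  have key := rate_mul_integral (B := B * (‖z‖ * z.re + (‖z‖ * a + z.re + a) + z.re + a)) hz ha η
    hd hcH'
    (fun s hs => (hq.norm_integrand_le hz ha hs).trans (mul_le_mul_of_nonneg_right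
      (mul_le_mul_of_nonneg_left (by
        have := mul_nonneg (norm_nonneg z) hz.le; linarith) hB) (by positivity)))
    (fun s hs => (hle s hs).trans (by
      have e₁ : s ^ (z.re + 1 - 1) = s ^ (z.re - 1) * s := by
        rw [← Real.rpow_add_one hs.ne']; congr 1; ring
      have e₂ : s ^ (z.re + 2 - 1) = s ^ (z.re - 1) * s * s := by
        rw [← Real.rpow_add_one hs.ne', ← Real.rpow_add_one hs.ne']; congr 1; ring
      rw [e₁, e₂, mul_assoc B]
      refine mul_le_mul_of_nonneg_left ?_ hB
      have hp : 0 ≤ s ^ (z.re - 1) := Real.rpow_nonneg hs.le _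
      have hzz := mul_nonneg (norm_nonneg z) hz.le
      have : ‖z‖ * z.re + (‖z‖ * a + z.re + a) * s + a * (s * s)
          ≤ (‖z‖ * z.re + (‖z‖ * a + z.re + a) + z.re + a) * (1 + s) ^ 2 := by
        nlinarith [mul_nonneg hzz hs.le, mul_nonneg hzz (sq_nonneg s), mul_nonneg hB₂ hs.le,
          mul_nonneg hB₂ (sq_nonneg s), mul_pos hz hs, mul_pos ha hs,
          mul_nonneg hz.le (sq_nonneg s), mul_nonneg ha.le (sq_nonneg s)]
      calc _ = s ^ (z.re - 1) * (‖z‖ * z.re + (‖z‖ * a + z.re + a) * s + a * (s * s)) := by ring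
        _ ≤ _ := mul_le_mul_of_nonneg_left this hp
        _ = _ := by ring))
  have hint : ∀ p : ℝ, 0 < p →
      IntegrableOn (fun s : ℝ => s ^ (p - 1) * Real.exp (-(a * s))) (Ioi 0) := fun p hp => by
    simpa using integrableOn_rpow_mul_exp (p := p - 1) (by linarith) ha
  have i₁ := (hint z.re hz).const_mul (‖z‖ * z.re)
  have i₂ := (hint (z.re + 1) (by linarith)).const_mul (‖z‖ * a + z.re + a)
  have i₃ := (hint (z.re + 2) (by linarith)).const_mul a
  have hnorm : √(η ^ 2 + a ^ 2) * ‖overlapRem q z a η‖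
      = ‖∫ s in Ioi (0 : ℝ), H' s * cexp (-rate a η * s)‖ := by
    rw [← key, norm_mul, norm_rate, overlapRem]
  rw [hnorm]
  refine (norm_integral_le_of_norm_le (((i₁.add i₂).add i₃).const_mul B) ?_).trans_eq ?_
  · filter_upwards [ae_restrict_mem measurableSet_Ioi] with s hs
    rw [norm_mul, norm_exp_rate, neg_mul]
    refine (mul_le_mul_of_nonneg_right (hle s hs) (Real.exp_pos _).le).trans_eq ?_
    simp only [Pi.add_apply]
    ring
  · rw [integral_const_mul, integral_add' (i₁.add i₂) i₃, integral_add' i₁ i₂, integral_const_mul,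
      integral_const_mul, integral_const_mul, Real.integral_rpow_mul_exp_neg_mul_Ioi hz ha,
      Real.integral_rpow_mul_exp_neg_mul_Ioi (by linarith) ha,
      Real.integral_rpow_mul_exp_neg_mul_Ioi (by linarith) ha]

theorem IsTame.exists_overlapRem_le (hq : IsTame q q' B) (hz : 0 < z.re) :
    ∃ K, 0 ≤ K ∧ ∀ a η : ℝ, 0 < a →
      √(η ^ 2 + a ^ 2) * ‖overlapRem q z a η‖ ≤ K * (1 + 1 / a) * (1 / a) ^ z.re := by
  have hB := hq.nonneg
  have g₀ := (Real.Gamma_pos_of_pos hz).le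
  have g₁ := (Real.Gamma_pos_of_pos (show 0 < z.re + 1 by linarith)).le
  have g₂ := (Real.Gamma_pos_of_pos (show 0 < z.re + 2 by linarith)).le
  refine ⟨B * (‖z‖ * z.re * Real.Gamma z.re + (‖z‖ + z.re + 1) * Real.Gamma (z.re + 1)
    + Real.Gamma (z.re + 2)), by positivity, fun a η ha => (hq.overlapRem_le hz ha η).trans ?_⟩
  have ha' : 0 < 1 / a := by positivity
  rw [Real.rpow_add_one ha'.ne', Real.rpow_add ha', Real.rpow_two]
  have hx : 0 ≤ (1 / a) ^ z.re := by positivity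
  generalize (1 / a) ^ z.re = x at hx
  have e : a * (1 / a) = 1 := by field_simp
  have : ‖z‖ * z.re * (x * Real.Gamma z.re)
      + (‖z‖ * a + z.re + a) * (x * (1 / a) * Real.Gamma (z.re + 1))
      + a * (x * (1 / a) ^ 2 * Real.Gamma (z.re + 2))
      = (‖z‖ * z.re * Real.Gamma z.re + ((‖z‖ + 1) + z.re * (1 / a)) * Real.Gamma (z.re + 1)
        + (1 / a) * Real.Gamma (z.re + 2)) * x := by
    linear_combination (x * (‖z‖ + 1) * Real.Gamma (z.re + 1)
      + x * (1 / a) * Real.Gamma (z.re + 2)) * e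
  rw [this, mul_assoc B, mul_assoc B]
  refine mul_le_mul_of_nonneg_left (mul_le_mul_of_nonneg_right ?_ hx) hB
  generalize 1 / a = y at ha'
  have hn := norm_nonneg z
  have k₁ : 0 ≤ ‖z‖ * z.re * Real.Gamma z.re * y := by positivity
  have k₂ : 0 ≤ z.re * Real.Gamma (z.re + 1) := by positivity
  have k₃ : 0 ≤ (‖z‖ + 1) * Real.Gamma (z.re + 1) * y := by positivity
  nlinarith

/-- The imaginary part of the exponent turns the argument of $a+i\eta$ into a real exponential;
since $a>0$, that argument is an arcsine. -/
theorem norm_sq_overlapMain (z : ℂ) (ha : 0 < a) (η : ℝ) :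
    ‖overlapMain z a η‖ ^ 2 = ‖Complex.Gamma (z + 1)‖ ^ 2 * ((η ^ 2 + a ^ 2) ^ (-(z.re + 1))
      * Real.exp (2 * z.im * Real.arcsin (η / √(η ^ 2 + a ^ 2)))) := by
  have hR : 0 ≤ η ^ 2 + a ^ 2 := by positivity
  rw [overlapMain, norm_mul, Complex.norm_cpow_of_ne_zero (rate_ne_zero ha η), norm_rate,
    Complex.arg_of_re_nonneg (by simpa using ha.le), norm_rate, rate_im, mul_pow, div_pow]
  congr 1
  rw [div_eq_mul_inv, ← inv_pow, ← Real.exp_neg, ← Real.exp_nat_mul, ← Real.rpow_natCast,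
    ← Real.rpow_mul (Real.sqrt_nonneg _), mul_comm _ ((2 : ℕ) : ℝ), Real.rpow_mul
    (Real.sqrt_nonneg _), Real.rpow_natCast, Real.sq_sqrt hR]
  simp only [neg_re, add_re, one_re, neg_im, add_im, one_im]
  congr 2
  push_cast
  ring

theorem norm_sq_overlapMain_le (z : ℂ) : ∃ C, 0 ≤ C ∧ ∀ a η : ℝ, 0 < a →
    ‖overlapMain z a η‖ ^ 2 ≤ C * (η ^ 2 + a ^ 2) ^ (-(z.re + 1)) := by
  refine ⟨‖Complex.Gamma (z + 1)‖ ^ 2 * Real.exp (2 * |z.im| * (Real.pi / 2)), by positivity,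
    fun a η ha => ?_⟩
  rw [norm_sq_overlapMain z ha, mul_assoc (_ ^ 2), mul_comm (Real.exp (2 * |z.im| * _))]
  refine mul_le_mul_of_nonneg_left (mul_le_mul_of_nonneg_left (Real.exp_le_exp.2 ?_)
    (by positivity)) (by positivity)
  rw [mul_assoc, mul_assoc]
  refine mul_le_mul_of_nonneg_left ((le_abs_self _).trans ?_) two_pos.le
  rw [abs_mul]
  exact mul_le_mul_of_nonneg_left (abs_le.2 ⟨Real.neg_pi_div_two_le_arcsin _,
    Real.arcsin_le_pi_div_two _⟩) (abs_nonneg _)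

theorem integrable_sq_add_sq_rpow {p : ℝ} (hp : 1 / 2 < p) (ha : 0 < a) :
    Integrable fun η : ℝ => (η ^ 2 + a ^ 2) ^ (-p) := by
  have h := integrable_rpow_neg_one_add_norm_sq (E := ℝ) (μ := volume) (r := 2 * p)
    (by simp; linarith)
  refine ((h.comp_div ha.ne').const_mul ((a ^ 2) ^ (-p))).congr (Eventually.of_forall fun η => ?_)
  change (a ^ 2) ^ (-p) * (1 + ‖η / a‖ ^ 2) ^ (-(2 * p) / 2) = _
  rw [show -(2 * p) / 2 = -p by ring, ← Real.mul_rpow (by positivity) (by positivity),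
    Real.norm_eq_abs, sq_abs]
  congr 1
  field_simp
  ring

theorem measurable_overlap (hq : Measurable q) (z : ℂ) (a σ : ℝ) :
    StronglyMeasurable fun η : ℝ => overlap q z a σ η := by
  have : Measurable fun p : ℝ × ℝ => (p.2 : ℂ) ^ z * cexp (-(a + I * p.1) * p.2) *
    (σ * I * √(p.1 ^ 2 + a ^ 2) - z / p.2 + a + q p.2 * (z.re - a * p.2)) := by fun_prop
  exact this.stronglyMeasurable.integral_prod_right

/-- Square integrability of the coefficients. In powers of $\eta^2+a^2$ the main part decays with
exponent $-(\varepsilon+\frac12)$, integrable because $\varepsilon>0$, and the remainder with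
exponent $-\frac32$. -/
theorem integrable_norm_sq_overlap (hq : IsTame q q' B) (hz : 0 < z.re) (ha : 0 < a) (σ : ℝ) :
    Integrable fun η : ℝ => 1 / √(η ^ 2 + a ^ 2) * ‖overlap q z a σ η‖ ^ 2 := by
  obtain ⟨C, hC₀, hC⟩ := norm_sq_overlapMain_le z
  obtain ⟨K, hK₀, hK⟩ := hq.exists_overlapRem_le hz
  set L := K * (1 + 1 / a) * (1 / a) ^ z.re with hL
  refine Integrable.mono' (((integrable_sq_add_sq_rpow (p := z.re + 1 / 2) (by linarith) ha).const_mul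
    (2 * (C * (2 * (σ ^ 2 + 1))))).add ((integrable_sq_add_sq_rpow (p := 3 / 2) (by norm_num)
      ha).const_mul (2 * L ^ 2))) ?_ (Eventually.of_forall fun η => ?_)
  · have := measurable_overlap hq.measurable z a σ
    exact ((by fun_prop : Measurable fun η : ℝ => 1 / √(η ^ 2 + a ^ 2)).aestronglyMeasurable).mul
      (this.norm.pow 2).aestronglyMeasurable
  have hR : 0 < η ^ 2 + a ^ 2 := by positivity
  have hS : √(η ^ 2 + a ^ 2) ^ 2 = η ^ 2 + a ^ 2 := Real.sq_sqrt hR.le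
  have e₀ : 1 / √(η ^ 2 + a ^ 2) = (η ^ 2 + a ^ 2) ^ (-(1 / 2) : ℝ) := by
    rw [Real.sqrt_eq_rpow, one_div, Real.rpow_neg hR.le]
  have h₁ := hC a η ha
  have h₂ : ‖overlapRem q z a η‖ ^ 2 ≤ L ^ 2 * (η ^ 2 + a ^ 2) ^ (-1 : ℝ) := by
    have := pow_le_pow_left₀ (by positivity) (hK a η ha) 2
    rw [mul_pow, hS] at this
    rw [Real.rpow_neg_one, ← div_eq_mul_inv, le_div_iff₀ hR]
    linarith
  have h₃ : ‖I * (σ * √(η ^ 2 + a ^ 2) - η : ℂ)‖ ^ 2 ≤ 2 * (σ ^ 2 + 1) * (η ^ 2 + a ^ 2) := by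
    rw [norm_mul, norm_I, one_mul, ← ofReal_mul, ← ofReal_sub, Complex.norm_real, Real.norm_eq_abs,
      sq_abs]
    nlinarith [sq_nonneg (σ * √(η ^ 2 + a ^ 2) + η), sq_nonneg a, sq_nonneg η]
  have h₄ : ‖overlap q z a σ η‖ ^ 2 ≤ 2 * (C * (η ^ 2 + a ^ 2) ^ (-(z.re + 1))
      * (2 * (σ ^ 2 + 1) * (η ^ 2 + a ^ 2))) + 2 * (L ^ 2 * (η ^ 2 + a ^ 2) ^ (-1 : ℝ)) := by
    rw [overlap_eq hq hz ha]
    have k := norm_add_le (overlapMain z a η * (I * (σ * √(η ^ 2 + a ^ 2) - η)))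
      (overlapRem q z a η)
    have k₂ := pow_le_pow_left₀ (norm_nonneg _) k 2
    have k₃ : ‖overlapMain z a η * (I * (σ * √(η ^ 2 + a ^ 2) - η))‖ ^ 2
      ≤ C * (η ^ 2 + a ^ 2) ^ (-(z.re + 1)) * (2 * (σ ^ 2 + 1) * (η ^ 2 + a ^ 2)) := by
      rw [norm_mul, mul_pow]
      exact mul_le_mul h₁ h₃ (by positivity) (by positivity)
    nlinarith [sq_nonneg (‖overlapMain z a η * (I * (σ * √(η ^ 2 + a ^ 2) - η))‖
      - ‖overlapRem q z a η‖)]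
  rw [Real.norm_of_nonneg (by positivity), e₀]
  refine (mul_le_mul_of_nonneg_left h₄ (by positivity)).trans_eq ?_
  have e₁ : (η ^ 2 + a ^ 2) ^ (-(z.re + 1 / 2)) = (η ^ 2 + a ^ 2) ^ (-(1 / 2) : ℝ)
      * (η ^ 2 + a ^ 2) ^ (-(z.re + 1)) * (η ^ 2 + a ^ 2) := by
    rw [← Real.rpow_add hR, ← Real.rpow_add_one hR.ne']
    congr 1; ring
  have e₂ : (η ^ 2 + a ^ 2) ^ (-(3 / 2) : ℝ) = (η ^ 2 + a ^ 2) ^ (-(1 / 2) : ℝ)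
      * (η ^ 2 + a ^ 2) ^ (-1 : ℝ) := by
    rw [← Real.rpow_add hR]
    congr 1; norm_num
  simp only [Pi.add_apply]
  rw [e₁, e₂]
  ring

end RN

/-! ### The limit of the number of particles -/

namespace RN

theorem exists_isTame_lapseQuot {M Q : ℝ} (hM : 0 < M) (hQ : Q ^ 2 < M ^ 2) :
    ∃ q' B, IsTame (lapseQuot M Q) q' B := by
  have hr := rPlus_pos (Q := Q) hM
  have hd := sub_pos.2 (rMinus_lt_rPlus hQ)
  have hdr : rPlus M Q - rMinus M Q ≤ rPlus M Q := by linarith [rMinus_nonneg (Q := Q) hM]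
  have hlq : lapseQuot M Q
    = fun s => (s + (rPlus M Q - rMinus M Q)) / (s + rPlus M Q) ^ 2 := rfl
  rw [hlq]
  generalize rPlus M Q - rMinus M Q = d at *
  generalize rPlus M Q = r at *
  have hle : ∀ s, 0 < s → (s + d) / (s + r) ≤ 1 := fun s hs =>
    (div_le_one (by positivity)).2 (by linarith)
  -- Since $0<d\le r$, the quotient is at most $1/r$ and its derivative at most $3/r^2$ in modulus;
  -- the sum serves for both.
  refine ⟨fun s => 1 / (s + r) ^ 2 - 2 * (s + d) / (s + r) ^ 3, 1 / r + 3 / r ^ 2, by fun_prop,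
    fun s hs => ?_, fun s hs => ?_, fun s hs => ?_, fun s hs => ?_⟩
  · have h₀ : s + r ≠ 0 := by positivity
    have := ((hasDerivAt_id s).add_const d).div (((hasDerivAt_id s).add_const r).pow 2)
      (pow_ne_zero 2 h₀)
    refine this.congr_deriv ?_
    simp only [id, Pi.pow_apply]
    field_simp
    ring
  · have h₀ : s + r ≠ 0 := by have : 0 < s := hs; positivity
    exact ContinuousAt.continuousWithinAt (by fun_prop (disch := positivity))
  · have h₁ : (s + d) / (s + r) ^ 2 = (s + d) / (s + r) * (1 / (s + r)) := by field_simp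
    have h₂ : 1 / (s + r) ≤ 1 / r := one_div_le_one_div_of_le hr (by linarith)
    have h₃ : 0 ≤ 3 / r ^ 2 := by positivity
    rw [abs_of_nonneg (by positivity), h₁]
    have := mul_le_mul (hle s hs) h₂ (by positivity) zero_le_one
    linarith
  · have h₁ : 1 / (s + r) ^ 2 - 2 * (s + d) / (s + r) ^ 3
      = (1 - 2 * ((s + d) / (s + r))) * (1 / (s + r) ^ 2) := by field_simp
    have h₂ : 1 / (s + r) ^ 2 ≤ 1 / r ^ 2 :=
      one_div_le_one_div_of_le (by positivity) (by gcongr; linarith)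
    have h₃ : |1 - 2 * ((s + d) / (s + r))| ≤ 3 := by
      have := hle s hs
      have : 0 ≤ (s + d) / (s + r) := by positivity
      rw [abs_le]; constructor <;> linarith
    have h₄ : 0 ≤ 1 / r := by positivity
    rw [h₁, abs_mul, abs_of_nonneg (show 0 ≤ 1 / (s + r) ^ 2 by positivity)]
    have := mul_le_mul h₃ h₂ (by positivity) (by norm_num)
    rw [mul_one_div (3 : ℝ)] at this
    linarith

/-! ### Functions of one angular momentum -/

/-- Each coefficient of the packet lives on one angular momentum, where integrals over modes become
Lebesgue integrals in $\eta$. -/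
theorem modeMeasure_restrict_fiber (n : ℤ) :
    modeMeasure.restrict {k | k.2 = n} = (volume : Measure ℝ).map fun η => (η, n) := by
  have h : {k : ModeIndex | k.2 = n} = univ ×ˢ {n} := by ext; simp
  rw [h, modeMeasure, ← Measure.prod_restrict, Measure.restrict_univ, Measure.restrict_singleton,
    Measure.count_singleton, one_smul, Measure.prod_dirac]

theorem measurableSet_fiber (n : ℤ) : MeasurableSet {k : ModeIndex | k.2 = n} :=
  measurable_snd (measurableSet_singleton n)

theorem memLp_of_fiber {F : ModeIndex → ℂ} {n : ℤ} (h : ∀ k, k.2 ≠ n → F k = 0)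
    (hF : MemLp (fun η => F (η, n)) 2 volume) : MemLp F 2 modeMeasure := by
  have h₁ : {k : ModeIndex | k.2 = n}.indicator F = F :=
    indicator_eq_self.2 fun k hk => by_contra fun hne => hk (h k hne)
  rw [← h₁, memLp_indicator_iff_restrict (measurableSet_fiber n), modeMeasure_restrict_fiber,
    (measurableEmbedding_prod_mk_right n).memLp_map_measure_iff]
  exact hF

theorem setIntegral_of_fiber {f : ModeIndex → ℝ} {n : ℤ} (h : ∀ k, k.2 ≠ n → f k = 0)
    {s : Set ℝ} (hs : MeasurableSet s) :
    ∫ k in {k | k.1 ∈ s}, f k ∂modeMeasure = ∫ η in s, f (η, n) := by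
  have hs' : MeasurableSet {k : ModeIndex | k.1 ∈ s} := measurable_fst hs
  rw [← integral_indicator hs', ← integral_indicator hs,
    ← setIntegral_eq_integral_of_forall_compl_eq_zero (s := {k : ModeIndex | k.2 = n}),
    modeMeasure_restrict_fiber, (measurableEmbedding_prod_mk_right n).integral_map]
  · rfl
  · intro k hk
    by_cases h' : k ∈ {k : ModeIndex | k.1 ∈ s}
    · rw [indicator_of_mem h', h k hk]
    · rw [indicator_of_notMem h']

/-! ### The expected number of particles -/

variable {q q' : ℝ → ℝ} {B : ℝ} {z : ℂ} {a : ℝ}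

/-- The interference of the two parts of `overlap`. -/
noncomputable def overlapCross (q : ℝ → ℝ) (z : ℂ) (a η : ℝ) : ℝ :=
  2 * (I * overlapMain z a η * conj (overlapRem q z a η)).re

/-- The remainder does not depend on the sign, so its square cancels. With $R=\sqrt{\eta^2+a^2}$ one
has $(R-\eta)^2-(R+\eta)^2=-4\eta R$, and the cross terms also carry a factor $R$, which the weight
$1/R$ removes. -/
theorem overlap_norm_sq_sub (hq : IsTame q q' B) (hz : 0 < z.re) (ha : 0 < a) (η : ℝ) :
    1 / √(η ^ 2 + a ^ 2) * ‖overlap q z a 1 η‖ ^ 2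
      - 1 / √(η ^ 2 + a ^ 2) * ‖overlap q z a (-1) η‖ ^ 2
      = 2 * (-2 * η * ‖overlapMain z a η‖ ^ 2 + overlapCross q z a η) := by
  have hR : √(η ^ 2 + a ^ 2) ≠ 0 := by positivity
  rw [overlap_eq hq hz ha, overlap_eq hq hz ha, overlapCross, ← mul_sub, one_div,
    inv_mul_eq_iff_eq_mul₀ hR]
  generalize √(η ^ 2 + a ^ 2) = t
  simp only [Complex.sq_norm, Complex.normSq_apply]
  simp
  ring

/-- The bound $(\eta^2+a^2)^{-\varepsilon}\le a^{-2\varepsilon}$ extracts the scale of the norm from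
the main part and leaves an integrable kernel. -/
theorem norm_overlapMain_mul_overlapRem_le (hq : IsTame q q' B) (hz : 0 < z.re) :
    ∃ K, 0 ≤ K ∧ ∀ a η : ℝ, 0 < a → ‖overlapMain z a η‖ * ‖overlapRem q z a η‖
      ≤ K * (1 + 1 / a) * (1 / a) ^ (2 * z.re) * (η ^ 2 + a ^ 2)⁻¹ := by
  obtain ⟨C, hC₀, hC⟩ := norm_sq_overlapMain_le z
  obtain ⟨K, hK₀, hK⟩ := hq.exists_overlapRem_le hz
  refine ⟨√C * K, by positivity, fun a η ha => ?_⟩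
  have hR : 0 < η ^ 2 + a ^ 2 := by positivity
  have hx : 0 ≤ (1 / a) ^ z.re := by positivity
  have h₁ : ‖overlapMain z a η‖ ^ 2
      ≤ C * (((1 / a) ^ z.re) ^ 2 * (η ^ 2 + a ^ 2)⁻¹) := by
    refine (hC a η ha).trans (mul_le_mul_of_nonneg_left ?_ hC₀)
    rw [neg_add, Real.rpow_add hR, Real.rpow_neg_one]
    refine mul_le_mul_of_nonneg_right ?_ (by positivity)
    refine (Real.rpow_le_rpow_of_nonpos (by positivity : 0 < a ^ 2)
      (le_add_of_nonneg_left (sq_nonneg η)) (by linarith)).trans_eq ?_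
    rw [one_div, Real.inv_rpow ha.le, ← Real.rpow_neg ha.le, ← Real.rpow_natCast,
      ← Real.rpow_natCast, ← Real.rpow_mul ha.le, ← Real.rpow_mul ha.le, mul_comm]
  have h₂ : ‖overlapRem q z a η‖ ^ 2
      ≤ (K * (1 + 1 / a) * (1 / a) ^ z.re) ^ 2 * (η ^ 2 + a ^ 2)⁻¹ := by
    have := pow_le_pow_left₀ (by positivity) (hK a η ha) 2
    rw [mul_pow, Real.sq_sqrt hR.le] at this
    rw [← div_eq_mul_inv, le_div_iff₀ hR]
    linarith
  refine (le_abs_self _).trans (abs_le_of_sq_le_sq ?_ (by positivity))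
  rw [mul_pow]
  refine (mul_le_mul h₁ h₂ (by positivity) (by positivity)).trans_eq ?_
  have hCs := Real.sq_sqrt hC₀
  have e : (1 / a) ^ (2 * z.re) = (1 / a) ^ z.re * (1 / a) ^ z.re := by
    rw [two_mul, Real.rpow_add (by positivity)]
  rw [e]
  linear_combination (-(K * (1 + 1 / a) * ((1 / a) ^ z.re * (1 / a) ^ z.re)
    * (η ^ 2 + a ^ 2)⁻¹) ^ 2) * hCs

theorem integrable_inv_sq_add_sq (ha : 0 < a) :
    Integrable fun η : ℝ => (η ^ 2 + a ^ 2)⁻¹ := by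
  simpa [Real.rpow_neg_one] using integrable_sq_add_sq_rpow (p := 1) (by norm_num) ha

theorem integral_inv_sq_add_sq (ha : 0 < a) :
    ∫ η : ℝ, (η ^ 2 + a ^ 2)⁻¹ = Real.pi * (1 / a) := by
  have h : ∀ η : ℝ, (η ^ 2 + a ^ 2)⁻¹ = (a ^ 2)⁻¹ * (1 + (η / a) ^ 2)⁻¹ := fun η => by
    rw [← mul_inv]
    congr 1
    field_simp
    ring
  simp_rw [h]
  rw [integral_const_mul, Measure.integral_comp_div (fun x => (1 + x ^ 2)⁻¹) a,
    integral_univ_inv_one_add_sq, abs_of_pos ha, smul_eq_mul]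
  field_simp

theorem measurable_overlapRem (hq : Measurable q) (z : ℂ) (a : ℝ) :
    StronglyMeasurable (overlapRem q z a) := by
  have : Measurable fun p : ℝ × ℝ => (p.2 : ℂ) ^ z * (q p.2 * (z.re - a * p.2) : ℝ)
      * cexp (-(a + I * p.1) * p.2) := by fun_prop
  exact this.stronglyMeasurable.integral_prod_right

theorem measurable_overlapMain (z : ℂ) (a : ℝ) : Measurable (overlapMain z a) := by
  have : Measurable (rate a) := by unfold rate; fun_prop
  exact (this.pow_const _).const_mul _

theorem abs_overlapCross_le (q : ℝ → ℝ) (z : ℂ) (a η : ℝ) :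
    |overlapCross q z a η| ≤ 2 * (‖overlapMain z a η‖ * ‖overlapRem q z a η‖) := by
  rw [overlapCross, abs_mul, abs_two]
  refine mul_le_mul_of_nonneg_left ((Complex.abs_re_le_norm _).trans_eq ?_) two_pos.le
  simp

/-- The integral of $(\eta^2+a^2)^{-1}$ is $\pi/a$, and this is the gain over the scale
$a^{-2\varepsilon}$ of the main term. -/
theorem integral_overlapCross_le (hq : IsTame q q' B) (hz : 0 < z.re) :
    ∃ K, 0 ≤ K ∧ ∀ a : ℝ, 0 < a → Integrable (overlapCross q z a) ∧
      |∫ η in Iio (0 : ℝ), overlapCross q z a η|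
        ≤ K * ((1 + 1 / a) * (1 / a)) * (1 / a) ^ (2 * z.re) := by
  obtain ⟨K, hK₀, hK⟩ := norm_overlapMain_mul_overlapRem_le hq hz
  refine ⟨2 * Real.pi * K, by positivity, fun a ha => ?_⟩
  have hle : ∀ η, ‖overlapCross q z a η‖
      ≤ 2 * (K * (1 + 1 / a) * (1 / a) ^ (2 * z.re)) * (η ^ 2 + a ^ 2)⁻¹ := fun η => by
    have := (abs_overlapCross_le q z a η).trans
      (mul_le_mul_of_nonneg_left (hK a η ha) two_pos.le)
    rw [Real.norm_eq_abs]
    linarith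
  have hint := (integrable_inv_sq_add_sq ha).const_mul
    (2 * (K * (1 + 1 / a) * (1 / a) ^ (2 * z.re)))
  have hmeas : Measurable (overlapCross q z a) := by
    have h₁ := (measurable_overlapRem hq.measurable z a).measurable
    have h₂ := measurable_overlapMain z a
    unfold overlapCross
    exact (Complex.measurable_re.comp ((h₂.const_mul I).mul
      (Complex.continuous_conj.measurable.comp h₁))).const_mul 2
  refine ⟨hint.mono' hmeas.aestronglyMeasurable (Eventually.of_forall hle), ?_⟩
  refine (norm_integral_le_of_norm_le hint.integrableOn (Eventually.of_forall hle)).trans ?_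
  refine (setIntegral_le_integral hint (Eventually.of_forall fun η => by
    simp only [Pi.zero_apply]; positivity)).trans_eq ?_
  rw [integral_const_mul, integral_inv_sq_add_sq ha]
  ring

theorem setIntegral_Iio_comp_neg (g : ℝ → ℝ) :
    ∫ x in Ioi (0 : ℝ), g (-x) = ∫ x in Iio (0 : ℝ), g x := by
  rw [integral_comp_neg_Ioi, neg_zero, integral_Iic_eq_integral_Iio]

theorem setIntegral_Iio_comp_mul (g : ℝ → ℝ) (ha : 0 < a) :
    a * ∫ x in Iio (0 : ℝ), g (a * x) = ∫ x in Iio (0 : ℝ), g x := by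
  have h := integral_comp_mul_left_Ioi' (fun x => g (-x)) 0 ha
  rw [mul_zero, setIntegral_Iio_comp_neg] at h
  rw [← h, ← setIntegral_Iio_comp_neg, smul_eq_mul]
  simp only [mul_neg]

/-- The scale invariant integral of the leading part. -/
noncomputable def leadingIntegral (z : ℂ) : ℝ :=
  ∫ η in Iio (0 : ℝ), |η| * ((η ^ 2 + 1) ^ (-(z.re + 1))
    * Real.exp (2 * z.im * Real.arcsin (η / √(η ^ 2 + 1))))

theorem integral_overlapMain (z : ℂ) (ha : 0 < a) :
    ∫ η in Iio (0 : ℝ), -2 * η * ‖overlapMain z a η‖ ^ 2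
      = 2 * ‖Complex.Gamma (z + 1)‖ ^ 2 * leadingIntegral z * (1 / a) ^ (2 * z.re) := by
  rw [← setIntegral_Iio_comp_mul _ ha, leadingIntegral, mul_comm (2 * _) (∫ η in _, _), mul_assoc,
    mul_comm (∫ η in _, _), ← integral_const_mul, ← integral_const_mul]
  refine setIntegral_congr_fun measurableSet_Iio fun η hη => ?_
  have hR : 0 < η ^ 2 + 1 := by positivity
  have e₁ : (a * η) ^ 2 + a ^ 2 = a ^ 2 * (η ^ 2 + 1) := by ring
  have e₂ : a * η / √((a * η) ^ 2 + a ^ 2) = η / √(η ^ 2 + 1) := by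
    rw [e₁, Real.sqrt_mul (sq_nonneg a), Real.sqrt_sq ha.le, mul_div_mul_left _ _ ha.ne']
  have e₃ : (a ^ 2) ^ (-(z.re + 1)) * a ^ 2 = (1 / a) ^ (2 * z.re) := by
    rw [one_div, Real.inv_rpow ha.le, ← Real.rpow_neg ha.le, ← Real.rpow_natCast a 2,
      ← Real.rpow_mul ha.le, ← Real.rpow_add ha]
    congr 1; push_cast; ring
  rw [norm_sq_overlapMain z ha, e₂, e₁, Real.mul_rpow (by positivity) hR.le, abs_of_neg hη, ← e₃]
  ring

theorem tendsto_particleNumber (hq : IsTame q q' B) (hz : 0 < z.re) {c : ℝ} (hc : 0 < c) :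
    Tendsto (fun a : ℝ => ((∫ η in Iio (0 : ℝ), 1 / √(η ^ 2 + a ^ 2) * ‖overlap q z a 1 η‖ ^ 2)
        - ∫ η in Iio (0 : ℝ), 1 / √(η ^ 2 + a ^ 2) * ‖overlap q z a (-1) η‖ ^ 2)
        / (2 * (c * (1 / a) ^ (2 * z.re)))) atTop
      (𝓝 (2 * ‖Complex.Gamma (z + 1)‖ ^ 2 * leadingIntegral z / c)) := by
  obtain ⟨K, hK₀, hK⟩ := integral_overlapCross_le hq hz
  have hinv : Tendsto (fun a : ℝ => 1 / a) atTop (𝓝 0) := by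
    simpa using tendsto_inv_atTop_zero (𝕜 := ℝ)
  have hlim : Tendsto (fun a : ℝ => K / c * ((1 + 1 / a) * (1 / a))) atTop (𝓝 0) := by
    simpa using (((hinv.const_add 1).mul hinv).const_mul (K / c))
  rw [tendsto_iff_norm_sub_tendsto_zero]
  refine squeeze_zero_norm' ?_ hlim
  filter_upwards [eventually_gt_atTop 0] with a ha
  obtain ⟨hi, hb⟩ := hK a ha
  have hx : 0 < (1 / a) ^ (2 * z.re) := by positivity
  have i₁ := (integrable_norm_sq_overlap hq hz ha 1).integrableOn (s := Iio 0)
  have i₂ := (integrable_norm_sq_overlap hq hz ha (-1)).integrableOn (s := Iio 0)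
  have i₃ := hi.integrableOn (s := Iio 0)
  -- The main term inherits integrability from the difference of squares and the cross term.
  have i₄ : IntegrableOn (fun η => -2 * η * ‖overlapMain z a η‖ ^ 2) (Iio 0) := by
    refine (((Integrable.sub i₁ i₂).const_mul (1 / 2)).sub i₃).congr
      (Eventually.of_forall fun η => ?_)
    simp only [Pi.sub_apply]
    rw [overlap_norm_sq_sub hq hz ha]
    ring
  rw [← integral_sub i₁ i₂]
  simp_rw [overlap_norm_sq_sub hq hz ha]
  rw [integral_const_mul, integral_add i₄ i₃, integral_overlapMain z ha, norm_norm,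
    Real.norm_eq_abs]
  generalize ∫ η in Iio (0 : ℝ), overlapCross q z a η = X at hb
  generalize (1 / a) ^ (2 * z.re) = x at hx hb
  have e : 2 * (2 * ‖Complex.Gamma (z + 1)‖ ^ 2 * leadingIntegral z * x + X) / (2 * (c * x))
      - 2 * ‖Complex.Gamma (z + 1)‖ ^ 2 * leadingIntegral z / c = X / (c * x) := by
    field_simp
    ring
  rw [e, abs_div, abs_of_pos (mul_pos hc hx), div_le_iff₀ (mul_pos hc hx)]
  refine hb.trans_eq ?_
  field_simp

/-- The two acute angles of a right triangle with legs $1$ and $|\eta|$ are complementary. The shift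
by $\pi/2$ is the source of a factor $e^{-\pi\hat\xi_0}$. -/
theorem arcsin_neg_div_sqrt {η : ℝ} (hη : η < 0) :
    Real.arcsin (η / √(η ^ 2 + 1)) = -(Real.pi / 2) + Real.arcsin (1 / √(η ^ 2 + 1)) := by
  have hR : 0 < η ^ 2 + 1 := by positivity
  have h : √(1 - (1 / √(η ^ 2 + 1)) ^ 2) = -η / √(η ^ 2 + 1) := by
    rw [div_pow, Real.sq_sqrt hR.le, Real.sqrt_eq_iff_mul_self_eq (by
      rw [one_pow, sub_nonneg, div_le_one hR]; nlinarith [sq_nonneg η])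
      (div_nonneg (by linarith) (Real.sqrt_nonneg _)), div_mul_div_comm,
      Real.mul_self_sqrt hR.le]
    field_simp
    ring
  have h₂ := Real.arccos_eq_arcsin (x := 1 / √(η ^ 2 + 1)) (by positivity)
  rw [h, neg_div, Real.arcsin_neg, Real.arccos] at h₂
  linarith

/-- The functional equation of $\Gamma$ gives $|z|^2=\xi^2+\varepsilon^2$, and
$e^{-2\pi\xi}|\Gamma_1|^2=e^{-\pi\xi}|\Gamma(z)|^2$ accounts for the shift of the arcsine. -/
theorem hawkingUnruh_eq {ε ξ : ℝ} (hε : 0 < ε) (hξ : 0 < ξ) :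
    2 * ‖Complex.Gamma (packetExponent ε ξ + 1)‖ ^ 2 * leadingIntegral (packetExponent ε ξ)
        / (4 * Real.pi * ξ * ((1 / 2) ^ (2 * ε) * Real.Gamma (2 * ε)))
      = hawkingUnruh ε ξ := by
  have hΓ : 0 < Real.Gamma (2 * ε) := Real.Gamma_pos_of_pos (by positivity)
  have hz₀ : packetExponent ε ξ ≠ 0 := fun h => by
    have := congrArg Complex.re h
    simp at this
    linarith
  have hnorm : ‖packetExponent ε ξ‖ ^ 2 = ξ ^ 2 + ε ^ 2 := by
    rw [Complex.sq_norm, Complex.normSq_apply, packetExponent_re, packetExponent_im]; ring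
  have hL : leadingIntegral (packetExponent ε ξ) = Real.exp (-(Real.pi * ξ))
      * ∫ η in Iio (0 : ℝ), |η| / (η ^ 2 + 1) ^ (ε + 1)
        * Real.exp (2 * ξ * Real.arcsin (1 / √(η ^ 2 + 1))) := by
    rw [leadingIntegral, ← integral_const_mul]
    refine setIntegral_congr_fun measurableSet_Iio fun η hη => ?_
    simp only [packetExponent_re, packetExponent_im]
    rw [arcsin_neg_div_sqrt hη, mul_add, Real.exp_add, Real.rpow_neg (by positivity),
      show 2 * ξ * -(Real.pi / 2) = -(Real.pi * ξ) by ring]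
    ring
  have hG : gammaOne ε ξ
      = Real.exp (Real.pi * ξ / 2) * Complex.Gamma (packetExponent ε ξ) := by
    rw [gammaOne, packetExponent, add_comm]
  have he : Real.exp (-2 * Real.pi * ξ) * Real.exp (Real.pi * ξ / 2) ^ 2
      = Real.exp (-(Real.pi * ξ)) := by
    rw [← Real.exp_nat_mul, ← Real.exp_add]
    congr 1; push_cast; ring
  rw [hawkingUnruh, Complex.Gamma_add_one _ hz₀, norm_mul, mul_pow, hnorm, hL, hG, norm_mul,
    mul_pow, Complex.norm_real, Real.norm_eq_abs, abs_of_pos (Real.exp_pos _),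
    mul_assoc (2 ^ (2 * ε)), ← mul_assoc (Real.exp (-2 * Real.pi * ξ)), he, one_div, Real.inv_rpow two_pos.le]
  generalize ∫ η in Iio (0 : ℝ), |η| / (η ^ 2 + 1) ^ (ε + 1)
        * Real.exp (2 * ξ * Real.arcsin (1 / √(η ^ 2 + 1))) = T
  have h2 : (0 : ℝ) < 2 ^ (2 * ε) := by positivity
  field_simp
  ring

/-! ### The coefficients of the normalized wave packet -/

/-- The coefficients with the angular momentum of the wave packet. -/
noncomputable def coeffFun (M Q : ℝ) (z : ℂ) (a N σ η : ℝ) : ℂ :=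
  2 * Real.pi * I * (modeNorm a η * cexp (-I * η * rPlus M Q)
    * overlap (lapseQuot M Q) z a σ η) / (√N : ℝ)

/-- The phase from the shift to the horizon has modulus one, and the mode normalization contributes
the weight $1/(2\sqrt{\eta^2+a^2})$. -/
theorem norm_sq_coeffFun (M Q : ℝ) (z : ℂ) (ha : 0 < a) {N : ℝ} (hN : 0 < N) (σ η : ℝ) :
    ‖coeffFun M Q z a N σ η‖ ^ 2
      = (1 / √(η ^ 2 + a ^ 2) * ‖overlap (lapseQuot M Q) z a σ η‖ ^ 2) / (2 * N) := by
  have hR : 0 < η ^ 2 + a ^ 2 := by positivity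
  have h₁ : ‖cexp (-I * η * rPlus M Q)‖ = 1 := by
    rw [Complex.norm_exp]; simp
  have h₂ : ((η ^ 2 + a ^ 2) ^ (1 / 4 : ℝ)) ^ 2 = √(η ^ 2 + a ^ 2) := by
    rw [← Real.rpow_natCast, ← Real.rpow_mul hR.le, Real.sqrt_eq_rpow]
    norm_num
  have h₃ : (2 * Real.pi * modeNorm a η) ^ 2 = 1 / (2 * √(η ^ 2 + a ^ 2)) := by
    have h2 : √2 ^ 2 = (2 : ℝ) := Real.sq_sqrt two_pos.le
    rw [modeNorm, ← h₂]
    have : (η ^ 2 + a ^ 2) ^ (1 / 4 : ℝ) ≠ 0 := by positivity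
    field_simp
    rw [h2]
  have h₄ : ‖coeffFun M Q z a N σ η‖
      = (2 * Real.pi * modeNorm a η) * ‖overlap (lapseQuot M Q) z a σ η‖ / √N := by
    have hm : 0 ≤ modeNorm a η := by unfold modeNorm; positivity
    simp only [coeffFun, norm_div, norm_mul, h₁, Complex.norm_real, norm_I, Real.norm_eq_abs,
      Complex.norm_two, abs_of_nonneg hm, abs_of_nonneg Real.pi_pos.le,
      abs_of_nonneg (Real.sqrt_nonneg N)]
    ring
  rw [h₄, div_pow, mul_pow, h₃, Real.sq_sqrt hN.le]
  field_simp

theorem memLp_coeffFun {M Q : ℝ} (hM : 0 < M) (hQ : Q ^ 2 < M ^ 2) (hz : 0 < z.re) (ha : 0 < a)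
    {N : ℝ} (hN : 0 < N) (σ : ℝ) : MemLp (coeffFun M Q z a N σ) 2 volume := by
  obtain ⟨q', B, hq⟩ := exists_isTame_lapseQuot hM hQ
  have hmeas : AEStronglyMeasurable (coeffFun M Q z a N σ) volume := by
    have h₁ := (measurable_overlap hq.measurable z a σ).measurable
    have h₂ : Measurable (modeNorm a) := by unfold modeNorm; fun_prop
    exact Measurable.aestronglyMeasurable (by unfold coeffFun; fun_prop)
  rw [memLp_two_iff_integrable_sq_norm hmeas]
  simp_rw [norm_sq_coeffFun M Q z ha hN σ]
  exact (integrable_norm_sq_overlap hq hz ha σ).div_const _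

variable {M Q ε η₀ N : ℝ} {m : ℤ} {C : SpacetimeFun} {fp fm : ℝ → ℤ → SpacetimeFun}

theorem coeffPlus_normalized (hM : 0 < M) (hQ : Q ^ 2 < M ^ 2)
    (hf : IsModeSystem M Q a fp fm) (hC : IsWavePacket M Q ε η₀ m a C)
    (hN : kgInner M Q 0 C C = N) (k : ModeIndex) :
    coeffPlus M Q fp (normalized M Q C) k
      = if k.2 = m then coeffFun M Q (packetExponent ε (xiHat M Q η₀)) a N (-1) k.1 else 0 := by
  rw [coeffPlus, kgInner_normalized_right, hN, ofReal_re,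
    kgInner_mode (σ := -1) hM hQ hC (fun ρ φ hρ => hf.value_plus _ _ ρ φ hρ) (fun ρ φ hρ => by
      simpa only [lambdaMinus, neg_one_mul, sub_eq_add_neg] using hf.velocity_plus k.1 k.2 ρ φ hρ)]
  split_ifs
  · rfl
  · exact zero_div _

/-- The mode involved is $f^-_{-k}$, hence the angular momentum $-m$ and the reflected argument. -/
theorem coeffMinus_normalized (hM : 0 < M) (hQ : Q ^ 2 < M ^ 2)
    (hf : IsModeSystem M Q a fp fm) (hC : IsWavePacket M Q ε η₀ m a C)
    (hN : kgInner M Q 0 C C = N) (k : ModeIndex) :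
    coeffMinus M Q fm (normalized M Q C) k
      = if k.2 = -m then -coeffFun M Q (packetExponent ε (xiHat M Q η₀)) a N 1 (-k.1) else 0 := by
  rw [coeffMinus, kgInner_normalized_right, hN, ofReal_re,
    kgInner_mode (σ := 1) hM hQ hC (fun ρ φ hρ => hf.value_minus _ _ ρ φ hρ) (fun ρ φ hρ => by
      simpa only [lambdaPlus, one_mul] using hf.velocity_minus (-k.1) (-k.2) ρ φ hρ)]
  simp only [show -k.2 = m ↔ k.2 = -m from neg_eq_iff_eq_neg]
  split_ifs
  · rfl
  · rw [zero_div, neg_zero]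

theorem memLp_coeffPlus (hM : 0 < M) (hQ : Q ^ 2 < M ^ 2) (hε : 0 < ε) (ha : 0 < a)
    (hf : IsModeSystem M Q a fp fm) (hC : IsWavePacket M Q ε η₀ m a C)
    (hN₀ : 0 < N) (hN : kgInner M Q 0 C C = N) :
    MemLp (coeffPlus M Q fp (normalized M Q C)) 2 modeMeasure := by
  refine memLp_of_fiber (n := m) (fun k hk => ?_) ?_
  · rw [coeffPlus_normalized hM hQ hf hC hN, if_neg hk]
  · simp_rw [coeffPlus_normalized hM hQ hf hC hN, if_true]
    exact memLp_coeffFun hM hQ (by simpa using hε) ha hN₀ _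

theorem memLp_coeffMinus (hM : 0 < M) (hQ : Q ^ 2 < M ^ 2) (hε : 0 < ε) (ha : 0 < a)
    (hf : IsModeSystem M Q a fp fm) (hC : IsWavePacket M Q ε η₀ m a C)
    (hN₀ : 0 < N) (hN : kgInner M Q 0 C C = N) :
    MemLp (coeffMinus M Q fm (normalized M Q C)) 2 modeMeasure := by
  refine memLp_of_fiber (n := -m) (fun k hk => ?_) ?_
  · rw [coeffMinus_normalized hM hQ hf hC hN, if_neg hk]
  · simp_rw [coeffMinus_normalized hM hQ hf hC hN, if_true]
    exact ((memLp_coeffFun hM hQ (by simpa using hε) ha hN₀ _).comp_measurePreserving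
      (Measure.measurePreserving_neg volume)).neg

/-- Reflecting $\eta$ brings the $C^-$ integral from $\eta>0$ to $\eta<0$, so that it can be
subtracted from the $C^+$ integral pointwise. -/
theorem form_numberOp_normalized (hM : 0 < M) (hQ : Q ^ 2 < M ^ 2) (hε : 0 < ε) (ha : 0 < a)
    (hf : IsModeSystem M Q a fp fm) (hC : IsWavePacket M Q ε η₀ m a C)
    (hN₀ : 0 < N) (hN : kgInner M Q 0 C C = N) {F : FieldRep.{u}} {Ψ : F.V}
    (hΨ : F.IsUnruhVacuum Ψ) :
    F.form Ψ (F.numberOp (coeffPlus M Q fp (normalized M Q C))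
        (coeffMinus M Q fm (normalized M Q C)) Ψ)
      = ((((∫ η in Iio (0 : ℝ), 1 / √(η ^ 2 + a ^ 2)
            * ‖overlap (lapseQuot M Q) (packetExponent ε (xiHat M Q η₀)) a 1 η‖ ^ 2)
          - ∫ η in Iio (0 : ℝ), 1 / √(η ^ 2 + a ^ 2)
            * ‖overlap (lapseQuot M Q) (packetExponent ε (xiHat M Q η₀)) a (-1) η‖ ^ 2)
          / (2 * N) : ℝ) : ℂ) := by
  rw [hΨ.form_numberOp (memLp_coeffPlus hM hQ hε ha hf hC hN₀ hN)
    (memLp_coeffMinus hM hQ hε ha hf hC hN₀ hN)]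
  congr 1
  rw [sub_div, ← integral_div, ← integral_div, ← setIntegral_Iio_comp_neg]
  congr 1
  · refine (setIntegral_of_fiber (n := -m) (fun k hk => ?_) measurableSet_Ioi).trans ?_
    · rw [coeffMinus_normalized hM hQ hf hC hN, if_neg hk]; simp
    · refine integral_congr_ae (Eventually.of_forall fun η => ?_)
      simp only [coeffMinus_normalized hM hQ hf hC hN, if_true, norm_neg]
      exact norm_sq_coeffFun M Q _ ha hN₀ 1 (-η)
  · refine (setIntegral_of_fiber (n := m) (fun k hk => ?_) measurableSet_Iio).trans ?_
    · rw [coeffPlus_normalized hM hQ hf hC hN, if_neg hk]; simp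
    · refine integral_congr_ae (Eventually.of_forall fun η => ?_)
      simp only [coeffPlus_normalized hM hQ hf hC hN, if_true]
      exact norm_sq_coeffFun M Q _ ha hN₀ (-1) η

end RN

/-! ### Existence, normalization and the limit -/

theorem mainTheorem2 (M Q ε η₀ : ℝ) (m : ℤ)
    (hM : 0 < M) (hQ : Q ^ 2 < M ^ 2) (hε : 0 < ε) (hη₀ : 0 < η₀)
    (fp fm : ℝ → ℝ → ℤ → RN.SpacetimeFun) (C : ℝ → RN.SpacetimeFun)
    (hmode : ∀ a : ℝ, 0 < a → RN.IsModeSystem M Q a (fp a) (fm a))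
    (hC : ∀ a : ℝ, 0 < a → RN.IsWavePacket M Q ε η₀ m a (C a)) :
    (∃ (F : RN.FieldRep.{0}) (Ψ : F.V), F.IsUnruhVacuum Ψ) ∧
    (∀ a : ℝ, 0 < a →
      RN.kgInner M Q 0 (RN.normalized M Q (C a)) (RN.normalized M Q (C a)) = 1 ∧
      MemLp (RN.coeffPlus M Q (fp a) (RN.normalized M Q (C a))) 2 RN.modeMeasure ∧
      MemLp (RN.coeffMinus M Q (fm a) (RN.normalized M Q (C a))) 2 RN.modeMeasure) ∧
    ∀ (F : ℝ → RN.FieldRep.{u}) (Ψ : (a : ℝ) → (F a).V),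
      (∀ a : ℝ, 0 < a → (F a).IsUnruhVacuum (Ψ a)) →
      Tendsto
        (fun a : ℝ => (F a).form (Ψ a)
          ((F a).numberOp (RN.coeffPlus M Q (fp a) (RN.normalized M Q (C a)))
            (RN.coeffMinus M Q (fm a) (RN.normalized M Q (C a))) (Ψ a)))
        atTop (𝓝 ((RN.hawkingUnruh ε (RN.xiHat M Q η₀) : ℝ) : ℂ)) := by
  have hξ := RN.xiHat_pos hM hQ hη₀
  have hΓ : 0 < Real.Gamma (2 * ε) := Real.Gamma_pos_of_pos (by positivity)
  have hN₀ : ∀ a : ℝ, 0 < a → 0 < 4 * Real.pi * RN.xiHat M Q η₀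
      * ((1 / (2 * a)) ^ (2 * ε) * Real.Gamma (2 * ε)) := fun a ha => by positivity
  have hN := fun a ha => RN.kgInner_self hM hQ hε ha (hC a ha)
  refine ⟨RN.exists_unruhVacuum, fun a ha => ⟨RN.kgInner_normalized (hN₀ a ha) (hN a ha),
    RN.memLp_coeffPlus hM hQ hε ha (hmode a ha) (hC a ha) (hN₀ a ha) (hN a ha),
    RN.memLp_coeffMinus hM hQ hε ha (hmode a ha) (hC a ha) (hN₀ a ha) (hN a ha)⟩,
    fun F Ψ hΨ => ?_⟩
  obtain ⟨q', B, hq⟩ := RN.exists_isTame_lapseQuot hM hQ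
  have hlim := RN.tendsto_particleNumber hq
    (z := RN.packetExponent ε (RN.xiHat M Q η₀)) (by simpa using hε)
    (show 0 < 4 * Real.pi * RN.xiHat M Q η₀ * ((1 / 2) ^ (2 * ε) * Real.Gamma (2 * ε)) by
      positivity)
  rw [RN.hawkingUnruh_eq hε hξ, RN.packetExponent_re] at hlim
  refine ((Complex.continuous_ofReal.tendsto _).comp hlim).congr' ?_
  filter_upwards [eventually_gt_atTop 0] with a ha
  rw [RN.form_numberOp_normalized hM hQ hε ha (hmode a ha) (hC a ha) (hN₀ a ha) (hN a ha)
    (hΨ a ha)]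
  -- This splits the norm of the packet into the constant given to `tendsto_particleNumber` and the
  -- power of `a` that the main term shares.
  have e : (1 / (2 * a)) ^ (2 * ε) = (1 / 2) ^ (2 * ε) * (1 / a) ^ (2 * ε) := by
    rw [← Real.mul_rpow (by positivity) (by positivity)]
    congr 1
    field_simp
  rw [e, Function.comp_apply]
  congr 2
  ring
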